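/- **Theorem 3.5.** Let $\Bbbk$ be an algebraically closed field of characteristic zero and let $G$ be a finite group with neutral element $e$. Let $\Bbbk_{par}G$ be the unital algebra generated by symbols $[g]$, $g\in G$, with relations $[e]=1$, $[g][h][h^{-1}]=[gh][h^{-1}]$ and $[g^{-1}][g][h]=[g^{-1}][gh]$. Put $\varepsilon_g=[g][g^{-1}]$ and let $A_{par}\subseteq \Bbbk_{par}G$ be the (commutative) subalgebra generated by the $\varepsilon_g$. Equip $\Bbbk_{par}G$ with left and right base algebra $A_{par}$ (identified by the identity map), all source and target maps $s_l,t_l,s_r,t_r$ equal to the inclusion, and $$\underline\Delta_l(m)=m\otimes_{A_{par}} m,\qquad \underline\Delta_r(m)=m\otimes_{A_{par}} m,\qquad \mathcal S(m)=[g_n^{-1}]\cdots[g_1^{-1}],$$ $$\underline\epsilon_l(m)=\varepsilon_{g_1}\varepsilon_{g_1g_2}\cdots\varepsilon_{g_1\cdots g_n},\qquad \underline\epsilon_r(m)=\underline\epsilon_l(\mathcal S(m))=\varepsilon_{g_n^{-1}}\varepsilon_{g_n^{-1}g_{n-1}^{-1}}\cdots\varepsilon_{g_n^{-1}\cdots g_1^{-1}}$$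 for every monomial $m=[g_1]\cdots[g_n]$. (The tensor product in $\underline\Delta_l$ is balanced for left multiplication by $A_{par}$ on both factors, the one in $\underline\Delta_r$ for right multiplication on both factors.) Let $\Gamma(G)$ be the finite groupoid whose objects are the subsets $X\subseteq G$ with $e\in X$ and whose arrows are the pairs $(g,X)$ with $\{e,g^{-1}\}\subseteq X$, with source $X$, target $gX$, composition $(g,hX)(h,X)=(gh,X)$ and inverse $(g,X)^{-1}=(g^{-1},gX)$. Its groupoid algebra $H=\Bbbk\Gamma(G)$ is a weak Hopf algebra with $\Delta(\gamma)=\gamma\otimes\gamma$, $\epsilon(\gamma)=1$, $S(\gamma)=\gamma^{-1}$. Equip it with left base algebra $H_t=\epsilon_t(H)$, right base algebra $H_s=\epsilon_s(H)$ (anti-isomorphic by the restriction of $\epsilon_s$), $s_l$ and $s_r$ the inclusions, $t_l=\epsilon_s'|_{H_t}$, $t_r=\epsilon_t'|_{H_s}$, $\underline\Delta_l$ and $\underline\Delta_r$ the composites of $\Delta$ with the projections to $H\otimes_{H_t}H$ and $H\otimes_{H_s}H$, $\underline\epsilon_l=\epsilon_t$, $\underline\epsilon_r=\epsilon_s$ and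 antipode $S$, where $$\epsilon_t(h)=\epsilon(1_{(1)}h)1_{(2)},\quad \epsilon_s(h)=1_{(1)}\epsilon(h1_{(2)}),\quad \epsilon_s'(h)=1_{(1)}\epsilon(1_{(2)}h),\quad \epsilon_t'(h)=\epsilon(h1_{(1)})1_{(2)}.$$ Then both structures are Hopf algebroids (a left bialgebroid and a right bialgebroid over anti-isomorphic base algebras together with an antipode, in the sense of Böhm), and there is an algebra isomorphism $\lambda:\Bbbk_{par}G\to\Bbbk\Gamma(G)$ with $$\lambda([g])=\sum_{X\supseteq\{e,g^{-1}\}}(g,X)\qquad (g\in G)$$ which is an isomorphism of Hopf algebroids: there are algebra isomorphisms $\varphi:A_{par}\to H_t$ and $\psi:A_{par}\to H_s$, compatible with the anti-isomorphisms of the base algebras, such that $(\lambda,\varphi)$ is a morphism of left bialgebroids and $(\lambda,\psi)$ is a morphism of right bialgebroids (compatibility with sources, targets, counits and comultiplications), and $\lambda$ commutes with the antipodes. -/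

import Mathlib

open scoped TensorProduct Pointwise

noncomputable section

namespace ParHopf

universe u v w

/-! ## Bialgebroids and Hopf algebroids

All structure maps are `k`-linear.  For a `k`-algebra `H` and a submodule `R` of `H ⊗[k] H` of
balancing relations, the quotient `(H ⊗[k] H) ⧸ R` is the tensor product over the base algebra. -/

section Bialgebroids

variable {k : Type*} [CommRing k] {H : Type*} [Ring H] [Algebra k H]

/-- The relations in the iterated tensor product: `R₁` in the first two factors, `R₂` in the
last two. For balancing relations `R₁` (over `A`) and `R₂` (over `B`) the quotient of
`H ⊗ (H ⊗ H)` by it is `H ⊗_A H ⊗_B H`. -/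
def tripleRel (R₁ R₂ : Submodule k (H ⊗[k] H)) : Submodule k (H ⊗[k] (H ⊗[k] H)) :=
  LinearMap.range ((TensorProduct.assoc k H H H).toLinearMap ∘ₗ R₁.subtype.rTensor H) ⊔
    LinearMap.range (R₂.subtype.lTensor H)

/-- The canonical map `(H ⊗_A H) ⊗ H → H ⊗_A H ⊗_B H`. -/
def tripleOfLeft (R₁ R₂ : Submodule k (H ⊗[k] H)) :
    ((H ⊗[k] H) ⧸ R₁) ⊗[k] H →ₗ[k] (H ⊗[k] (H ⊗[k] H)) ⧸ tripleRel R₁ R₂ :=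
  TensorProduct.lift (R₁.liftQ
    (TensorProduct.curry ((tripleRel R₁ R₂).mkQ ∘ₗ (TensorProduct.assoc k H H H).toLinearMap))
    (by
      intro r hr
      rw [LinearMap.mem_ker]
      ext h
      simp only [TensorProduct.curry_apply, LinearMap.comp_apply, LinearMap.zero_apply,
        Submodule.mkQ_apply, Submodule.Quotient.mk_eq_zero]
      exact Submodule.mem_sup_left ⟨(⟨r, hr⟩ : R₁) ⊗ₜ[k] h, by simp⟩))

/-- The canonical map `H ⊗ (H ⊗_B H) → H ⊗_A H ⊗_B H`. -/
def tripleOfRight (R₁ R₂ : Submodule k (H ⊗[k] H)) :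
    H ⊗[k] ((H ⊗[k] H) ⧸ R₂) →ₗ[k] (H ⊗[k] (H ⊗[k] H)) ⧸ tripleRel R₁ R₂ :=
  TensorProduct.lift (LinearMap.flip (R₂.liftQ
    (LinearMap.flip (TensorProduct.curry (tripleRel R₁ R₂).mkQ))
    (by
      intro r hr
      rw [LinearMap.mem_ker]
      ext h
      simp only [TensorProduct.curry_apply, LinearMap.flip_apply, LinearMap.zero_apply,
        Submodule.mkQ_apply, Submodule.Quotient.mk_eq_zero]
      exact Submodule.mem_sup_right ⟨h ⊗ₜ[k] (⟨r, hr⟩ : R₂), by simp⟩)))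

theorem tripleOfLeft_tmul (R₁ R₂ : Submodule k (H ⊗[k] H)) (a b c : H) :
    tripleOfLeft R₁ R₂ (R₁.mkQ (a ⊗ₜ b) ⊗ₜ c) = (tripleRel R₁ R₂).mkQ (a ⊗ₜ (b ⊗ₜ c)) := by
  simp [tripleOfLeft]

theorem tripleOfRight_tmul (R₁ R₂ : Submodule k (H ⊗[k] H)) (a b c : H) :
    tripleOfRight R₁ R₂ (a ⊗ₜ R₂.mkQ (b ⊗ₜ c)) = (tripleRel R₁ R₂).mkQ (a ⊗ₜ (b ⊗ₜ c)) := by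
  simp [tripleOfRight]

/-- `(Δ₁ ⊗ id) ∘ Δ₂ = (id ⊗ Δ₂) ∘ Δ₁` as maps `H → H ⊗_A H ⊗_B H`, where
`Δ₁ : H → H ⊗_A H` and `Δ₂ : H → H ⊗_B H`. The maps `Δ₁ ⊗ id` and `id ⊗ Δ₂` are evaluated on
arbitrary representatives in `H ⊗[k] H`, so that their being well defined on the relevant
elements is part of the condition. -/
def MixedCoassoc {R₁ R₂ : Submodule k (H ⊗[k] H)}
    (Δ₁ : H →ₗ[k] (H ⊗[k] H) ⧸ R₁) (Δ₂ : H →ₗ[k] (H ⊗[k] H) ⧸ R₂) : Prop :=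
  ∀ (h : H) (x y : H ⊗[k] H), R₂.mkQ x = Δ₂ h → R₁.mkQ y = Δ₁ h →
    tripleOfLeft R₁ R₂ (Δ₁.rTensor H x) = tripleOfRight R₁ R₂ (Δ₂.lTensor H y)

variable {A : Type*} [Ring A] [Algebra k A]

/-- The relations defining `H ⊗_A H` for the bimodule structure `a ▷ h ◁ b = s(a) t(b) h`. -/
def leftRel (s t : A →ₗ[k] H) : Submodule k (H ⊗[k] H) :=
  Submodule.span k {x | ∃ (a : A) (g h : H), x = (t a * g) ⊗ₜ[k] h - g ⊗ₜ[k] (s a * h)}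

/-- The relations defining `H ⊗_A H` for the bimodule structure `a ▷ h ◁ b = h s(b) t(a)`. -/
def rightRel (s t : A →ₗ[k] H) : Submodule k (H ⊗[k] H) :=
  Submodule.span k {x | ∃ (a : A) (g h : H), x = (g * s a) ⊗ₜ[k] h - g ⊗ₜ[k] (h * t a)}

/-- The structure maps of a left bialgebroid (without its laws). -/
structure LeftBialgebroidData (k A H : Type*) [CommRing k] [Ring A] [Algebra k A]
    [Ring H] [Algebra k H] where
  /-- source -/
  s : A →ₗ[k] H
  /-- target -/
  t : A →ₗ[k] H
  /-- comultiplication `H → H ⊗_A H` -/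
  Δ : H →ₗ[k] (H ⊗[k] H) ⧸ leftRel s t
  /-- counit -/
  ε : H →ₗ[k] A

/-- The structure maps of a right bialgebroid (without its laws). -/
structure RightBialgebroidData (k A H : Type*) [CommRing k] [Ring A] [Algebra k A]
    [Ring H] [Algebra k H] where
  /-- source -/
  s : A →ₗ[k] H
  /-- target -/
  t : A →ₗ[k] H
  /-- comultiplication `H → H ⊗_A H` -/
  Δ : H →ₗ[k] (H ⊗[k] H) ⧸ rightRel s t
  /-- counit -/
  ε : H →ₗ[k] A

/-- `x` represents the coproduct of `h`, that is, `x = h₍₁₎ ⊗ h₍₂₎` in `H ⊗_A H`. -/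
def LeftBialgebroidData.Rep (D : LeftBialgebroidData k A H) (x : H ⊗[k] H) (h : H) : Prop :=
  (leftRel D.s D.t).mkQ x = D.Δ h

/-- `x` represents the coproduct of `h`, that is, `x = h⁽¹⁾ ⊗ h⁽²⁾` in `H ⊗_A H`. -/
def RightBialgebroidData.Rep (D : RightBialgebroidData k A H) (x : H ⊗[k] H) (h : H) : Prop :=
  (rightRel D.s D.t).mkQ x = D.Δ h

/-- The laws of a left bialgebroid. -/
structure IsLeftBialgebroid (D : LeftBialgebroidData k A H) : Prop where
  /-- the source is an algebra morphism -/
  s_one : D.s 1 = 1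
  s_mul : ∀ a b, D.s (a * b) = D.s a * D.s b
  /-- the target is an algebra anti-morphism -/
  t_one : D.t 1 = 1
  t_mul : ∀ a b, D.t (a * b) = D.t b * D.t a
  s_t_comm : ∀ a b, D.s a * D.t b = D.t b * D.s a
  /-- `Δ` is a morphism of bimodules -/
  comul_bimod : ∀ a b h x, D.Rep x h → D.Rep ((D.s a ⊗ₜ[k] D.t b) * x) (D.s a * D.t b * h)
  /-- `ε` is a morphism of bimodules -/
  counit_bimod : ∀ a b h, D.ε (D.s a * D.t b * h) = a * D.ε h * b
  /-- coassociativity in `H ⊗_A H ⊗_A H` -/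
  coassoc : MixedCoassoc D.Δ D.Δ
  /-- `ε(h₍₁₎) ▷ h₍₂₎ = h` -/
  counit_left : ∀ h x, D.Rep x h → LinearMap.mul' k H ((D.s ∘ₗ D.ε).rTensor H x) = h
  /-- `h₍₁₎ ◁ ε(h₍₂₎) = h` -/
  counit_right : ∀ h x, D.Rep x h →
    LinearMap.mul' k H ((D.t ∘ₗ D.ε).rTensor H (TensorProduct.comm k H H x)) = h
  /-- `Δ` takes values in the Takeuchi product -/
  takeuchi : ∀ h x a, D.Rep x h →
    (leftRel D.s D.t).mkQ (x * (D.t a ⊗ₜ[k] 1)) = (leftRel D.s D.t).mkQ (x * (1 ⊗ₜ[k] D.s a))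
  /-- `Δ` is a morphism of algebras to the Takeuchi product -/
  comul_one : D.Rep (1 ⊗ₜ[k] 1) 1
  comul_mul : ∀ g h x y, D.Rep x g → D.Rep y h → D.Rep (x * y) (g * h)
  counit_one : D.ε 1 = 1
  counit_mul_s : ∀ g h, D.ε (g * h) = D.ε (g * D.s (D.ε h))
  counit_mul_t : ∀ g h, D.ε (g * h) = D.ε (g * D.t (D.ε h))

/-- The laws of a right bialgebroid. -/
structure IsRightBialgebroid (D : RightBialgebroidData k A H) : Prop where
  /-- the source is an algebra morphism -/
  s_one : D.s 1 = 1
  s_mul : ∀ a b, D.s (a * b) = D.s a * D.s b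
  /-- the target is an algebra anti-morphism -/
  t_one : D.t 1 = 1
  t_mul : ∀ a b, D.t (a * b) = D.t b * D.t a
  s_t_comm : ∀ a b, D.s a * D.t b = D.t b * D.s a
  /-- `Δ` is a morphism of bimodules -/
  comul_bimod : ∀ a b h x, D.Rep x h → D.Rep (x * (D.t a ⊗ₜ[k] D.s b)) (h * D.s b * D.t a)
  /-- `ε` is a morphism of bimodules -/
  counit_bimod : ∀ a b h, D.ε (h * D.s b * D.t a) = a * D.ε h * b
  /-- coassociativity in `H ⊗_A H ⊗_A H` -/
  coassoc : MixedCoassoc D.Δ D.Δ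
  /-- `h⁽¹⁾ ◁ ε(h⁽²⁾) = h` -/
  counit_right : ∀ h x, D.Rep x h → LinearMap.mul' k H ((D.s ∘ₗ D.ε).lTensor H x) = h
  /-- `ε(h⁽¹⁾) ▷ h⁽²⁾ = h` -/
  counit_left : ∀ h x, D.Rep x h →
    LinearMap.mul' k H ((D.t ∘ₗ D.ε).lTensor H (TensorProduct.comm k H H x)) = h
  /-- `Δ` takes values in the Takeuchi product -/
  takeuchi : ∀ h x a, D.Rep x h →
    (rightRel D.s D.t).mkQ ((D.s a ⊗ₜ[k] 1) * x) = (rightRel D.s D.t).mkQ ((1 ⊗ₜ[k] D.t a) * x)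
  /-- `Δ` is a morphism of algebras to the Takeuchi product -/
  comul_one : D.Rep (1 ⊗ₜ[k] 1) 1
  comul_mul : ∀ g h x y, D.Rep x g → D.Rep y h → D.Rep (x * y) (g * h)
  counit_one : D.ε 1 = 1
  counit_mul_s : ∀ g h, D.ε (g * h) = D.ε (D.s (D.ε g) * h)
  counit_mul_t : ∀ g h, D.ε (g * h) = D.ε (D.t (D.ε g) * h)

variable {B : Type*} [Ring B] [Algebra k B]

/-- The structure maps of a Hopf algebroid over the base algebras `A` (left) and `B` (right). -/
structure HopfAlgebroidData (k A B H : Type*) [CommRing k] [Ring A] [Algebra k A]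
    [Ring B] [Algebra k B] [Ring H] [Algebra k H] where
  left : LeftBialgebroidData k A H
  right : RightBialgebroidData k B H
  /-- the anti-isomorphism between the base algebras -/
  θ : A →ₗ[k] B
  /-- the antipode -/
  S : H →ₗ[k] H

/-- The laws of a Hopf algebroid. -/
structure IsHopfAlgebroid (D : HopfAlgebroidData k A B H) : Prop where
  isLeft : IsLeftBialgebroid D.left
  isRight : IsRightBialgebroid D.right
  θ_bijective : Function.Bijective D.θ
  θ_one : D.θ 1 = 1
  θ_mul : ∀ a b, D.θ (a * b) = D.θ b * D.θ a
  S_one : D.S 1 = 1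
  S_mul : ∀ g h, D.S (g * h) = D.S h * D.S g
  sl_εl_tr : D.left.s ∘ₗ D.left.ε ∘ₗ D.right.t = D.right.t
  tl_εl_sr : D.left.t ∘ₗ D.left.ε ∘ₗ D.right.s = D.right.s
  sr_εr_tl : D.right.s ∘ₗ D.right.ε ∘ₗ D.left.t = D.left.t
  tr_εr_sl : D.right.t ∘ₗ D.right.ε ∘ₗ D.left.s = D.left.s
  coassoc_lr : MixedCoassoc D.left.Δ D.right.Δ
  coassoc_rl : MixedCoassoc D.right.Δ D.left.Δ
  S_bimod : ∀ a b h, D.S (D.left.t a * h * D.right.t b) = D.right.s b * D.S h * D.left.s a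
  antipode_left : ∀ h x, D.left.Rep x h →
    LinearMap.mul' k H (D.S.rTensor H x) = D.right.s (D.right.ε h)
  antipode_right : ∀ h x, D.right.Rep x h →
    LinearMap.mul' k H (D.S.lTensor H x) = D.left.s (D.left.ε h)

section Morphisms

variable {H' A' B' : Type*} [Ring H'] [Algebra k H'] [Ring A'] [Algebra k A']
  [Ring B'] [Algebra k B']

/-- `(Φ, φ)` is a morphism of left bialgebroids. -/
structure IsLeftBialgebroidHom (D : LeftBialgebroidData k A H) (D' : LeftBialgebroidData k A' H')
    (Φ : H →ₗ[k] H') (φ : A →ₗ[k] A') : Prop where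
  source : D'.s ∘ₗ φ = Φ ∘ₗ D.s
  target : D'.t ∘ₗ φ = Φ ∘ₗ D.t
  counit : D'.ε ∘ₗ Φ = φ ∘ₗ D.ε
  /-- `Δ' ∘ Φ = (Φ ⊗ Φ) ∘ Δ` -/
  comul : ∀ h x, D.Rep x h → D'.Rep (TensorProduct.map Φ Φ x) (Φ h)

/-- `(Φ, φ)` is a morphism of right bialgebroids. -/
structure IsRightBialgebroidHom (D : RightBialgebroidData k A H)
    (D' : RightBialgebroidData k A' H') (Φ : H →ₗ[k] H') (φ : A →ₗ[k] A') : Prop where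
  source : D'.s ∘ₗ φ = Φ ∘ₗ D.s
  target : D'.t ∘ₗ φ = Φ ∘ₗ D.t
  counit : D'.ε ∘ₗ Φ = φ ∘ₗ D.ε
  /-- `Δ' ∘ Φ = (Φ ⊗ Φ) ∘ Δ` -/
  comul : ∀ h x, D.Rep x h → D'.Rep (TensorProduct.map Φ Φ x) (Φ h)

/-- The algebra isomorphisms `Φ : H → H'`, `φ : A → A'`, `ψ : B → B'` form an isomorphism of
Hopf algebroids. -/
structure IsHopfAlgebroidIso (D : HopfAlgebroidData k A B H) (D' : HopfAlgebroidData k A' B' H')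
    (Φ : H ≃ₐ[k] H') (φ : A ≃ₐ[k] A') (ψ : B ≃ₐ[k] B') : Prop where
  left : IsLeftBialgebroidHom D.left D'.left Φ.toLinearMap φ.toLinearMap
  right : IsRightBialgebroidHom D.right D'.right Φ.toLinearMap ψ.toLinearMap
  base : ψ.toLinearMap ∘ₗ D.θ = D'.θ ∘ₗ φ.toLinearMap
  antipode : Φ.toLinearMap ∘ₗ D.S = D'.S ∘ₗ Φ.toLinearMap

end Morphisms

end Bialgebroids

/-! ## Weak Hopf algebras and their Hopf algebroids -/

section Weak

variable (k : Type*) [CommRing k] (H : Type*) [Ring H] [Algebra k H] [Coalgebra k H]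

open Coalgebra in
/-- The laws relating the algebra and the coalgebra structure of a weak bialgebra. -/
structure IsWeakBialgebra : Prop where
  comul_mul : ∀ x y : H, comul (R := k) (x * y) = comul x * comul y
  /-- `ε(xyz) = ε(x y₍₁₎) ε(y₍₂₎ z)` -/
  counit_mul : ∀ x y z : H, counit (R := k) (x * y * z) =
    LinearMap.mul' k k (TensorProduct.map (counit ∘ₗ LinearMap.mulLeft k x)
      (counit ∘ₗ LinearMap.mulRight k z) (comul y))
  /-- `ε(xyz) = ε(x y₍₂₎) ε(y₍₁₎ z)` -/
  counit_mul_swap : ∀ x y z : H, counit (R := k) (x * y * z) =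
    LinearMap.mul' k k (TensorProduct.map (counit ∘ₗ LinearMap.mulRight k z)
      (counit ∘ₗ LinearMap.mulLeft k x) (comul y))
  /-- `(Δ(1) ⊗ 1)(1 ⊗ Δ(1)) = 1₍₁₎ ⊗ 1₍₂₎ ⊗ 1₍₃₎` -/
  comul_one : TensorProduct.assoc k H H H (comul (1 : H) ⊗ₜ[k] 1) * (1 ⊗ₜ[k] comul (1 : H)) =
    (comul (R := k)).lTensor H (comul (1 : H))
  /-- `(1 ⊗ Δ(1))(Δ(1) ⊗ 1) = 1₍₁₎ ⊗ 1₍₂₎ ⊗ 1₍₃₎` -/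
  comul_one_swap : (1 ⊗ₜ[k] comul (1 : H)) * TensorProduct.assoc k H H H (comul (1 : H) ⊗ₜ[k] 1) =
    (comul (R := k)).lTensor H (comul (1 : H))

open Coalgebra in
/-- `ε_t(h) = ε(1₍₁₎ h) 1₍₂₎` -/
def epsT : H →ₗ[k] H :=
  (TensorProduct.lid k H).toLinearMap ∘ₗ (counit (R := k) (A := H)).rTensor H ∘ₗ
    LinearMap.mulLeft k (comul (R := k) (1 : H)) ∘ₗ (TensorProduct.mk k H H).flip 1

open Coalgebra in
/-- `ε_s(h) = 1₍₁₎ ε(h 1₍₂₎)` -/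
def epsS : H →ₗ[k] H :=
  (TensorProduct.rid k H).toLinearMap ∘ₗ (counit (R := k) (A := H)).lTensor H ∘ₗ
    LinearMap.mulRight k (comul (R := k) (1 : H)) ∘ₗ TensorProduct.mk k H H 1

open Coalgebra in
/-- `ε_s'(h) = 1₍₁₎ ε(1₍₂₎ h)` -/
def epsS' : H →ₗ[k] H :=
  (TensorProduct.rid k H).toLinearMap ∘ₗ (counit (R := k) (A := H)).lTensor H ∘ₗ
    LinearMap.mulLeft k (comul (R := k) (1 : H)) ∘ₗ TensorProduct.mk k H H 1

open Coalgebra in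
/-- `ε_t'(h) = ε(h 1₍₁₎) 1₍₂₎` -/
def epsT' : H →ₗ[k] H :=
  (TensorProduct.lid k H).toLinearMap ∘ₗ (counit (R := k) (A := H)).rTensor H ∘ₗ
    LinearMap.mulRight k (comul (R := k) (1 : H)) ∘ₗ (TensorProduct.mk k H H).flip 1

open Coalgebra in
/-- The laws of a weak Hopf algebra with antipode `S`. -/
structure IsWeakHopfAlgebra (S : H →ₗ[k] H) : Prop extends IsWeakBialgebra k H where
  /-- `S(h₍₁₎) h₍₂₎ = ε_s(h)` -/
  antipode_left : LinearMap.mul' k H ∘ₗ S.rTensor H ∘ₗ comul = epsS k H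
  /-- `h₍₁₎ S(h₍₂₎) = ε_t(h)` -/
  antipode_right : LinearMap.mul' k H ∘ₗ S.lTensor H ∘ₗ comul = epsT k H
  /-- `S(h₍₁₎) h₍₂₎ S(h₍₃₎) = S(h)` -/
  antipode_mid : LinearMap.mul' k H ∘ₗ
    TensorProduct.map S (LinearMap.mul' k H ∘ₗ S.lTensor H ∘ₗ comul) ∘ₗ comul = S

variable {k H}

namespace IsWeakBialgebra

open Coalgebra

theorem comul_epsT_aux (h : H) (z : H ⊗[k] H) :
    comul (R := k) (TensorProduct.lid k H ((counit (R := k) (A := H)).rTensor H (z * (h ⊗ₜ 1)))) =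
      TensorProduct.lid k (H ⊗[k] H) ((counit (R := k) (A := H)).rTensor (H ⊗[k] H)
        ((comul (R := k)).lTensor H z * (h ⊗ₜ 1))) := by
  induction z with
  | zero => simp
  | add x y hx hy => simp only [add_mul, map_add, hx, hy]
  | tmul a b => simp

theorem comul_epsS_aux (h : H) (z : H ⊗[k] H) :
    comul (R := k) (TensorProduct.rid k H ((counit (R := k) (A := H)).lTensor H ((1 ⊗ₜ h) * z))) =
      TensorProduct.rid k (H ⊗[k] H) ((counit (R := k) (A := H)).lTensor (H ⊗[k] H)
        ((1 ⊗ₜ h) * (comul (R := k)).rTensor H z)) := by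
  induction z with
  | zero => simp
  | add x y hx hy => simp only [mul_add, map_add, hx, hy]
  | tmul a b => simp

theorem comul_epsT (hW : IsWeakBialgebra k H) (h : H) :
    comul (R := k) (epsT k H h) = comul (R := k) (1 : H) * (epsT k H h ⊗ₜ 1) := by
  have key : ∀ u w : H ⊗[k] H, TensorProduct.lid k (H ⊗[k] H)
      ((counit (R := k) (A := H)).rTensor (H ⊗[k] H)
        ((1 ⊗ₜ u) * TensorProduct.assoc k H H H (w ⊗ₜ 1) * (h ⊗ₜ 1))) =
      u * (TensorProduct.lid k H ((counit (R := k) (A := H)).rTensor H (w * (h ⊗ₜ 1))) ⊗ₜ 1) := by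
    intro u w
    induction w with
    | zero => simp
    | add x y hx hy => simp only [TensorProduct.add_tmul, map_add, mul_add, add_mul, hx, hy]
    | tmul a b => simp [← TensorProduct.smul_tmul']
  change comul (R := k) (TensorProduct.lid k H ((counit (R := k) (A := H)).rTensor H
    (comul (R := k) (1 : H) * (h ⊗ₜ 1)))) = _
  rw [comul_epsT_aux, ← hW.comul_one_swap, key]
  rfl

theorem comul_epsT' (hW : IsWeakBialgebra k H) (h : H) :
    comul (R := k) (epsT k H h) = (epsT k H h ⊗ₜ 1) * comul (R := k) (1 : H) := by
  have key : ∀ u w : H ⊗[k] H, TensorProduct.lid k (H ⊗[k] H)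
      ((counit (R := k) (A := H)).rTensor (H ⊗[k] H)
        (TensorProduct.assoc k H H H (w ⊗ₜ 1) * (1 ⊗ₜ u) * (h ⊗ₜ 1))) =
      (TensorProduct.lid k H ((counit (R := k) (A := H)).rTensor H (w * (h ⊗ₜ 1))) ⊗ₜ 1) * u := by
    intro u w
    induction w with
    | zero => simp
    | add x y hx hy => simp only [TensorProduct.add_tmul, map_add, add_mul, hx, hy]
    | tmul a b => simp [← TensorProduct.smul_tmul']
  change comul (R := k) (TensorProduct.lid k H ((counit (R := k) (A := H)).rTensor H
    (comul (R := k) (1 : H) * (h ⊗ₜ 1)))) = _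
  rw [comul_epsT_aux, ← hW.comul_one, key]
  rfl

theorem comul_epsS (hW : IsWeakBialgebra k H) (h : H) :
    comul (R := k) (epsS k H h) = (1 ⊗ₜ epsS k H h) * comul (R := k) (1 : H) := by
  have key : ∀ u w : H ⊗[k] H, TensorProduct.rid k (H ⊗[k] H)
      ((counit (R := k) (A := H)).lTensor (H ⊗[k] H) ((1 ⊗ₜ h) *
        (TensorProduct.assoc k H H H).symm
          ((1 ⊗ₜ w) * TensorProduct.assoc k H H H (u ⊗ₜ 1)))) =
      (1 ⊗ₜ TensorProduct.rid k H ((counit (R := k) (A := H)).lTensor H ((1 ⊗ₜ h) * w))) * u := by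
    intro u w
    induction w with
    | zero => simp
    | add x y hx hy => simp only [TensorProduct.tmul_add, map_add, mul_add, add_mul, hx, hy]
    | tmul a b =>
      induction u with
      | zero => simp
      | add x y hx hy => simp only [TensorProduct.add_tmul, map_add, mul_add, hx, hy]
      | tmul c d => simp [TensorProduct.smul_tmul', TensorProduct.tmul_smul]
  change comul (R := k) (TensorProduct.rid k H ((counit (R := k) (A := H)).lTensor H
    ((1 ⊗ₜ h) * comul (R := k) (1 : H)))) = _
  rw [comul_epsS_aux, ← Coalgebra.coassoc_symm_apply, ← hW.comul_one_swap, key]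
  rfl

theorem comul_epsS' (hW : IsWeakBialgebra k H) (h : H) :
    comul (R := k) (epsS k H h) = comul (R := k) (1 : H) * (1 ⊗ₜ epsS k H h) := by
  have key : ∀ u w : H ⊗[k] H, TensorProduct.rid k (H ⊗[k] H)
      ((counit (R := k) (A := H)).lTensor (H ⊗[k] H) ((1 ⊗ₜ h) *
        (TensorProduct.assoc k H H H).symm
          (TensorProduct.assoc k H H H (u ⊗ₜ 1) * (1 ⊗ₜ w)))) =
      u * (1 ⊗ₜ TensorProduct.rid k H ((counit (R := k) (A := H)).lTensor H ((1 ⊗ₜ h) * w))) := by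
    intro u w
    induction w with
    | zero => simp
    | add x y hx hy => simp only [TensorProduct.tmul_add, map_add, mul_add, hx, hy]
    | tmul a b =>
      induction u with
      | zero => simp
      | add x y hx hy => simp only [TensorProduct.add_tmul, map_add, mul_add, add_mul, hx, hy]
      | tmul c d => simp [TensorProduct.smul_tmul', TensorProduct.tmul_smul]
  change comul (R := k) (TensorProduct.rid k H ((counit (R := k) (A := H)).lTensor H
    ((1 ⊗ₜ h) * comul (R := k) (1 : H)))) = _
  rw [comul_epsS_aux, ← Coalgebra.coassoc_symm_apply, ← hW.comul_one, key]
  rfl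

theorem epsT_of_comul {z : H} (hz : comul (R := k) z = comul (R := k) (1 : H) * (z ⊗ₜ 1)) :
    epsT k H z = z := by
  change TensorProduct.lid k H ((counit (R := k) (A := H)).rTensor H
    (comul (R := k) (1 : H) * (z ⊗ₜ 1))) = z
  rw [← hz, Coalgebra.rTensor_counit_comul]
  simp

theorem epsS_of_comul {z : H} (hz : comul (R := k) z = (1 ⊗ₜ z) * comul (R := k) (1 : H)) :
    epsS k H z = z := by
  change TensorProduct.rid k H ((counit (R := k) (A := H)).lTensor H
    ((1 ⊗ₜ z) * comul (R := k) (1 : H))) = z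
  rw [← hz, Coalgebra.lTensor_counit_comul]
  simp

/-- The subalgebra `H_t = Im(ε_t)`. -/
def targetAlg (hW : IsWeakBialgebra k H) : Subalgebra k H where
  carrier := Set.range (epsT k H)
  add_mem' := by
    rintro _ _ ⟨a, rfl⟩ ⟨b, rfl⟩
    exact ⟨a + b, map_add _ _ _⟩
  mul_mem' := by
    rintro _ _ ⟨a, rfl⟩ ⟨b, rfl⟩
    refine ⟨_, epsT_of_comul ?_⟩
    rw [hW.comul_mul, hW.comul_epsT' a, mul_assoc, ← hW.comul_mul, one_mul, hW.comul_epsT b,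
      ← mul_assoc, ← hW.comul_epsT' a, hW.comul_epsT a, mul_assoc,
      Algebra.TensorProduct.tmul_mul_tmul, one_mul]
  algebraMap_mem' r := by
    refine ⟨_, epsT_of_comul ?_⟩
    rw [Algebra.algebraMap_eq_smul_one, map_smul, ← TensorProduct.smul_tmul', mul_smul_comm,
      ← Algebra.TensorProduct.one_def, mul_one]

/-- The subalgebra `H_s = Im(ε_s)`. -/
def sourceAlg (hW : IsWeakBialgebra k H) : Subalgebra k H where
  carrier := Set.range (epsS k H)
  add_mem' := by
    rintro _ _ ⟨a, rfl⟩ ⟨b, rfl⟩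
    exact ⟨a + b, map_add _ _ _⟩
  mul_mem' := by
    rintro _ _ ⟨a, rfl⟩ ⟨b, rfl⟩
    refine ⟨_, epsS_of_comul ?_⟩
    rw [hW.comul_mul, hW.comul_epsS a, mul_assoc, ← hW.comul_mul, one_mul, hW.comul_epsS b,
      ← mul_assoc, Algebra.TensorProduct.tmul_mul_tmul, one_mul]
  algebraMap_mem' r := by
    refine ⟨_, epsS_of_comul ?_⟩
    rw [Algebra.algebraMap_eq_smul_one, map_smul, TensorProduct.tmul_smul, smul_mul_assoc,
      ← Algebra.TensorProduct.one_def, one_mul]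

end IsWeakBialgebra

/-- `ε_t` as a map `H → H_t`. -/
def IsWeakBialgebra.toTarget (hW : IsWeakBialgebra k H) : H →ₗ[k] hW.targetAlg where
  toFun h := ⟨epsT k H h, h, rfl⟩
  map_add' a b := Subtype.ext (map_add (epsT k H) a b)
  map_smul' r a := Subtype.ext (map_smul (epsT k H) r a)

/-- `ε_s` as a map `H → H_s`. -/
def IsWeakBialgebra.toSource (hW : IsWeakBialgebra k H) : H →ₗ[k] hW.sourceAlg where
  toFun h := ⟨epsS k H h, h, rfl⟩
  map_add' a b := Subtype.ext (map_add (epsS k H) a b)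
  map_smul' r a := Subtype.ext (map_smul (epsS k H) r a)

/-- The Hopf algebroid structure maps of a weak Hopf algebra: left base `H_t` with
`s_l` the inclusion, `t_l = ε_s'|`, `Δ_l = π ∘ Δ`, `ε_l = ε_t`; right base `H_s` with `s_r` the
inclusion, `t_r = ε_t'|`, `Δ_r = π ∘ Δ`, `ε_r = ε_s`; the antipode is the given one. The
anti-isomorphism `H_t → H_s` is the restriction of `ε_s`. -/
def IsWeakHopfAlgebra.hopfAlgebroidData {S : H →ₗ[k] H} (hW : IsWeakHopfAlgebra k H S) :
    HopfAlgebroidData k hW.targetAlg hW.sourceAlg H where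
  left :=
    { s := hW.targetAlg.val.toLinearMap
      t := epsS' k H ∘ₗ hW.targetAlg.val.toLinearMap
      Δ := (leftRel hW.targetAlg.val.toLinearMap
        (epsS' k H ∘ₗ hW.targetAlg.val.toLinearMap)).mkQ ∘ₗ Coalgebra.comul
      ε := hW.toTarget }
  right :=
    { s := hW.sourceAlg.val.toLinearMap
      t := epsT' k H ∘ₗ hW.sourceAlg.val.toLinearMap
      Δ := (rightRel hW.sourceAlg.val.toLinearMap
        (epsT' k H ∘ₗ hW.sourceAlg.val.toLinearMap)).mkQ ∘ₗ Coalgebra.comul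
      ε := hW.toSource }
  θ := hW.toSource ∘ₗ hW.targetAlg.val.toLinearMap
  S := S

end Weak

/-! ## Groupoid algebras -/

section Groupoids

open CategoryTheory

/-- The arrows of a groupoid. -/
structure Arr (C : Type u) [Groupoid.{v} C] where
  /-- source -/
  src : C
  /-- target -/
  tgt : C
  hom : src ⟶ tgt

/-- The algebra of the groupoid `C` over `k`: the free module on the set of arrows. -/
def GroupoidAlgebra (k : Type w) [CommRing k] (C : Type u) [Groupoid.{v} C] : Type (max u v w) :=
  Arr C →₀ k

namespace GroupoidAlgebra

variable {k : Type w} [CommRing k] {C : Type u} [Groupoid.{v} C]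

instance : AddCommGroup (GroupoidAlgebra k C) := inferInstanceAs (AddCommGroup (Arr C →₀ k))

instance : Module k (GroupoidAlgebra k C) := inferInstanceAs (Module k (Arr C →₀ k))

/-- The coalgebra for which the arrows are group-like: `Δ(γ) = γ ⊗ γ` and `ε(γ) = 1`. -/
instance : Coalgebra k (GroupoidAlgebra k C) := inferInstanceAs (Coalgebra k (Arr C →₀ k))

variable (k) in
/-- The arrow `γ` as an element of the groupoid algebra. -/
def arr (γ : Arr C) : GroupoidAlgebra k C := Finsupp.single γ (1 : k)

theorem comul_arr (γ : Arr C) :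
    Coalgebra.comul (R := k) (arr k γ) = arr k γ ⊗ₜ[k] arr k γ := by
  refine (Finsupp.comul_single k (Arr C) k γ 1).trans ?_
  simp only [CommSemiring.comul_apply, TensorProduct.map_tmul, Finsupp.lsingle_apply]
  rfl

theorem counit_arr (γ : Arr C) : Coalgebra.counit (R := k) (arr k γ) = 1 := by
  refine (Finsupp.counit_single k (Arr C) k γ 1).trans ?_
  simp

/-- The linear map with prescribed values on the arrows. -/
def extend {M : Type*} [AddCommGroup M] [Module k M] (f : Arr C → M) :
    GroupoidAlgebra k C →ₗ[k] M :=
  Finsupp.linearCombination k f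

@[simp] theorem extend_arr {M : Type*} [AddCommGroup M] [Module k M] (f : Arr C → M)
    (γ : Arr C) : extend f (arr k γ) = f γ := by
  refine (Finsupp.linearCombination_single k _ _).trans (one_smul _ _)

theorem hom_ext {M : Type*} [AddCommGroup M] [Module k M] {f g : GroupoidAlgebra k C →ₗ[k] M}
    (h : ∀ γ, f (arr k γ) = g (arr k γ)) : f = g := by
  refine Finsupp.lhom_ext' fun γ => LinearMap.ext_ring (h γ)

open Classical in
/-- The product of two arrows: `γ δ` (first `δ`, then `γ`) if `s(γ) = t(δ)`, and `0` otherwise. -/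
def arrMul (γ δ : Arr C) : GroupoidAlgebra k C :=
  if h : δ.tgt = γ.src then arr k ⟨δ.src, γ.tgt, δ.hom ≫ eqToHom h ≫ γ.hom⟩ else 0

/-- The multiplication as a bilinear map. -/
def mulHom : GroupoidAlgebra k C →ₗ[k] GroupoidAlgebra k C →ₗ[k] GroupoidAlgebra k C :=
  extend fun γ => extend fun δ => arrMul γ δ

instance : Mul (GroupoidAlgebra k C) := ⟨fun a b => mulHom a b⟩

theorem mul_def (a b : GroupoidAlgebra k C) : a * b = mulHom a b := rfl

theorem arr_mul_arr (γ δ : Arr C) : arr k γ * arr k δ = arrMul γ δ := by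
  simp [mul_def, mulHom]

theorem arr_mul_of_eq {x y z : C} (f : x ⟶ y) (g : y ⟶ z) :
    arr k ⟨y, z, g⟩ * arr k ⟨x, y, f⟩ = arr k ⟨x, z, f ≫ g⟩ := by
  simp [arr_mul_arr, arrMul]

theorem arr_mul_of_ne {γ δ : Arr C} (h : δ.tgt ≠ γ.src) : arr k γ * arr k δ = 0 := by
  simp [arr_mul_arr, arrMul, h]

theorem induction_on {p : GroupoidAlgebra k C → Prop} (a : GroupoidAlgebra k C) (zero : p 0)
    (add : ∀ a b, p a → p b → p (a + b)) (smul_arr : ∀ (r : k) γ, p (r • arr k γ)) : p a := by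
  refine Finsupp.induction_linear (motive := p) a zero add fun γ r => ?_
  have h : (Finsupp.single γ r : Arr C →₀ k) = r • Finsupp.single γ (1 : k) := by simp
  exact h ▸ smul_arr r γ

theorem mulHom_arr_assoc (γ δ η : Arr C) : mulHom (mulHom (arr k γ) (arr k δ)) (arr k η) =
    mulHom (arr k γ) (mulHom (arr k δ) (arr k η)) := by
  simp only [← mul_def]
  obtain ⟨x, y, f⟩ := η
  obtain ⟨y', z, g⟩ := δ
  obtain ⟨z', w, h⟩ := γ
  by_cases h1 : y = y'
  · subst h1
    rw [arr_mul_of_eq]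
    by_cases h2 : z = z'
    · subst h2
      simp only [arr_mul_of_eq, Category.assoc]
    · rw [arr_mul_of_ne (δ := ⟨y, z, g⟩) h2, arr_mul_of_ne (δ := ⟨x, z, f ≫ g⟩) h2, mul_def,
        map_zero, LinearMap.zero_apply]
  · rw [arr_mul_of_ne (γ := ⟨y', z, g⟩) (δ := ⟨x, y, f⟩) h1, mul_def _ 0, map_zero]
    by_cases h2 : z = z'
    · subst h2
      rw [arr_mul_of_eq, arr_mul_of_ne (γ := ⟨y', w, g ≫ h⟩) (δ := ⟨x, y, f⟩) h1]
    · rw [arr_mul_of_ne (δ := ⟨y', z, g⟩) h2, mul_def, map_zero, LinearMap.zero_apply]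

theorem mulHom_assoc (a b c : GroupoidAlgebra k C) :
    mulHom (mulHom a b) c = mulHom a (mulHom b c) := by
  induction a using induction_on with
  | zero => simp
  | add a a' ha ha' => simp only [map_add, LinearMap.add_apply, ha, ha']
  | smul_arr r γ =>
    induction b using induction_on with
    | zero => simp
    | add b b' hb hb' => simp only [map_add, LinearMap.add_apply, hb, hb']
    | smul_arr r' δ =>
      induction c using induction_on with
      | zero => simp
      | add c c' hc hc' => simp only [map_add, hc, hc']
      | smul_arr r'' η => simp only [map_smul, LinearMap.smul_apply, mulHom_arr_assoc]

variable [Fintype C]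

/-- The unit is the sum of the identity arrows. -/
instance : One (GroupoidAlgebra k C) := ⟨∑ x : C, arr k ⟨x, x, 𝟙 x⟩⟩

theorem one_def : (1 : GroupoidAlgebra k C) = ∑ x : C, arr k ⟨x, x, 𝟙 x⟩ := rfl

theorem mulHom_one_left (a : GroupoidAlgebra k C) : mulHom 1 a = a := by
  suffices h : mulHom (1 : GroupoidAlgebra k C) = LinearMap.id from LinearMap.congr_fun h a
  refine hom_ext ?_
  rintro ⟨x, y, f⟩
  rw [one_def, map_sum, LinearMap.sum_apply, Finset.sum_eq_single y]
  · exact (arr_mul_of_eq f (𝟙 y)).trans (by rw [Category.comp_id]; rfl)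
  · intro z _ hz
    exact arr_mul_of_ne (k := k) (γ := ⟨z, z, 𝟙 z⟩) (δ := ⟨x, y, f⟩) hz.symm
  · simp

theorem mulHom_one_right (a : GroupoidAlgebra k C) : mulHom a 1 = a := by
  suffices h : (mulHom (k := k) (C := C)).flip 1 = LinearMap.id from LinearMap.congr_fun h a
  refine hom_ext ?_
  rintro ⟨x, y, f⟩
  rw [LinearMap.flip_apply, one_def, map_sum, Finset.sum_eq_single x]
  · exact (arr_mul_of_eq (𝟙 x) f).trans (by rw [Category.id_comp]; rfl)
  · intro z _ hz
    exact arr_mul_of_ne (k := k) (γ := ⟨x, y, f⟩) (δ := ⟨z, z, 𝟙 z⟩) hz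
  · simp

instance : Ring (GroupoidAlgebra k C) :=
  { (inferInstance : AddCommGroup (GroupoidAlgebra k C)) with
    mul := fun a b => mulHom a b
    one := ∑ x : C, arr k ⟨x, x, 𝟙 x⟩
    left_distrib := fun a b c => map_add (mulHom a) b c
    right_distrib := fun a b c => by
      change mulHom (a + b) c = mulHom a c + mulHom b c
      rw [map_add, LinearMap.add_apply]
    zero_mul := fun a => by
      change mulHom 0 a = 0
      rw [map_zero, LinearMap.zero_apply]
    mul_zero := fun a => map_zero (mulHom a)
    mul_assoc := mulHom_assoc
    one_mul := mulHom_one_left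
    mul_one := mulHom_one_right }

instance : Algebra k (GroupoidAlgebra k C) :=
  Algebra.ofModule
    (fun r a b => by
      change mulHom (r • a) b = r • mulHom a b
      rw [map_smul, LinearMap.smul_apply])
    (fun r a b => map_smul (mulHom a) r b)

/-- The antipode `S(γ) = γ⁻¹`. -/
def antipode : GroupoidAlgebra k C →ₗ[k] GroupoidAlgebra k C :=
  extend fun γ => arr k ⟨γ.tgt, γ.src, Groupoid.inv γ.hom⟩

theorem comul_one' : Coalgebra.comul (R := k) (1 : GroupoidAlgebra k C) =
    ∑ x : C, arr k ⟨x, x, 𝟙 x⟩ ⊗ₜ[k] arr k ⟨x, x, 𝟙 x⟩ := by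
  rw [one_def, map_sum]
  simp only [comul_arr]

theorem counit_mul_arr_mul (a b : GroupoidAlgebra k C) (δ : Arr C) :
    Coalgebra.counit (R := k) (a * arr k δ * b) =
      Coalgebra.counit (R := k) (a * arr k δ) * Coalgebra.counit (R := k) (arr k δ * b) := by
  induction a using induction_on with
  | zero => simp
  | add a a' ha ha' => simp only [map_add, add_mul, ha, ha']
  | smul_arr r γ =>
    induction b using induction_on with
    | zero => simp
    | add b b' hb hb' => simp only [map_add, mul_add, hb, hb']
    | smul_arr r' η =>
      simp only [smul_mul_assoc, mul_smul_comm, map_smul, smul_eq_mul]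
      suffices h : Coalgebra.counit (R := k) (arr k γ * arr k δ * arr k η) =
          Coalgebra.counit (R := k) (arr k γ * arr k δ) *
            Coalgebra.counit (R := k) (arr k δ * arr k η) by
        rw [h]
        ring
      obtain ⟨x, y, f⟩ := η
      obtain ⟨y', z, g⟩ := δ
      obtain ⟨z', w, h⟩ := γ
      by_cases h2 : z = z'
      · subst h2
        rw [arr_mul_of_eq, counit_arr, one_mul]
        by_cases h1 : y = y'
        · subst h1
          rw [arr_mul_of_eq, arr_mul_of_eq, counit_arr, counit_arr]
        · rw [arr_mul_of_ne (γ := ⟨y', w, g ≫ h⟩) (δ := ⟨x, y, f⟩) h1,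
            arr_mul_of_ne (γ := ⟨y', z, g⟩) (δ := ⟨x, y, f⟩) h1]
      · rw [arr_mul_of_ne (δ := ⟨y', z, g⟩) h2]
        simp

/-- The groupoid algebra is a weak bialgebra. -/
theorem isWeakBialgebra : IsWeakBialgebra k (GroupoidAlgebra k C) where
  comul_mul x y := by
    induction x using induction_on with
    | zero => simp
    | add a a' ha ha' => simp only [map_add, add_mul, ha, ha']
    | smul_arr r γ =>
      induction y using induction_on with
      | zero => simp
      | add b b' hb hb' => simp only [map_add, mul_add, hb, hb']
      | smul_arr r' δ =>
        simp only [smul_mul_assoc, mul_smul_comm, map_smul, comul_arr,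
          Algebra.TensorProduct.tmul_mul_tmul]
        obtain ⟨x, y, f⟩ := δ
        obtain ⟨y', z, g⟩ := γ
        by_cases h : y = y'
        · subst h
          simp only [arr_mul_of_eq, comul_arr]
        · rw [arr_mul_of_ne (γ := ⟨y', z, g⟩) (δ := ⟨x, y, f⟩) h]
          simp
  counit_mul x y z := by
    induction y using induction_on with
    | zero => simp
    | add b b' hb hb' => simp only [map_add, mul_add, add_mul, hb, hb']
    | smul_arr r δ =>
      simp only [smul_mul_assoc, mul_smul_comm, map_smul, comul_arr, TensorProduct.map_tmul,
        LinearMap.mul'_apply, LinearMap.comp_apply, LinearMap.mulLeft_apply,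
        LinearMap.mulRight_apply, counit_mul_arr_mul]
  counit_mul_swap x y z := by
    induction y using induction_on with
    | zero => simp
    | add b b' hb hb' => simp only [map_add, mul_add, add_mul, hb, hb']
    | smul_arr r δ =>
      simp only [smul_mul_assoc, mul_smul_comm, map_smul, comul_arr, TensorProduct.map_tmul,
        LinearMap.mul'_apply, LinearMap.comp_apply, LinearMap.mulLeft_apply,
        LinearMap.mulRight_apply, counit_mul_arr_mul]
      rw [mul_comm (Coalgebra.counit (R := k) (x * arr k δ))]
  comul_one := by
    simp only [comul_one', TensorProduct.sum_tmul, TensorProduct.tmul_sum, map_sum,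
      TensorProduct.assoc_tmul, LinearMap.lTensor_tmul, comul_arr, Finset.sum_mul_sum,
      Algebra.TensorProduct.tmul_mul_tmul, one_mul, mul_one]
    refine Finset.sum_congr rfl fun x _ => ?_
    rw [Finset.sum_eq_single x, arr_mul_of_eq, Category.comp_id]
    · intro y _ hy
      rw [arr_mul_of_ne (γ := ⟨x, x, 𝟙 x⟩) (δ := ⟨y, y, 𝟙 y⟩) hy]
      simp
    · simp
  comul_one_swap := by
    simp only [comul_one', TensorProduct.sum_tmul, TensorProduct.tmul_sum, map_sum,
      TensorProduct.assoc_tmul, LinearMap.lTensor_tmul, comul_arr, Finset.sum_mul_sum,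
      Algebra.TensorProduct.tmul_mul_tmul, one_mul, mul_one]
    refine Finset.sum_congr rfl fun x _ => ?_
    rw [Finset.sum_eq_single x, arr_mul_of_eq, Category.comp_id]
    · intro y _ hy
      rw [arr_mul_of_ne (γ := ⟨x, x, 𝟙 x⟩) (δ := ⟨y, y, 𝟙 y⟩) hy]
      simp
    · simp

/-- `ε_t(γ) = t(γ)`. -/
theorem epsT_arr (γ : Arr C) :
    epsT k (GroupoidAlgebra k C) (arr k γ) = arr k ⟨γ.tgt, γ.tgt, 𝟙 γ.tgt⟩ := by
  obtain ⟨x, y, f⟩ := γ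
  simp only [epsT, LinearMap.comp_apply, LinearMap.flip_apply, TensorProduct.mk_apply,
    LinearMap.mulLeft_apply, comul_one', Finset.sum_mul, Algebra.TensorProduct.tmul_mul_tmul,
    map_sum, LinearMap.rTensor_tmul, mul_one, LinearEquiv.coe_coe, TensorProduct.lid_tmul]
  rw [Finset.sum_eq_single y]
  · rw [arr_mul_of_eq, counit_arr, one_smul]
  · intro z _ hz
    rw [arr_mul_of_ne (γ := ⟨z, z, 𝟙 z⟩) (δ := ⟨x, y, f⟩) hz.symm, map_zero, zero_smul]
  · simp

/-- `ε_s(γ) = s(γ)`. -/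
theorem epsS_arr (γ : Arr C) :
    epsS k (GroupoidAlgebra k C) (arr k γ) = arr k ⟨γ.src, γ.src, 𝟙 γ.src⟩ := by
  obtain ⟨x, y, f⟩ := γ
  simp only [epsS, LinearMap.comp_apply, TensorProduct.mk_apply,
    LinearMap.mulRight_apply, comul_one', Finset.mul_sum, Algebra.TensorProduct.tmul_mul_tmul,
    map_sum, LinearMap.lTensor_tmul, one_mul, LinearEquiv.coe_coe, TensorProduct.rid_tmul]
  rw [Finset.sum_eq_single x]
  · rw [arr_mul_of_eq, counit_arr, one_smul]
  · intro z _ hz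
    rw [arr_mul_of_ne (γ := ⟨x, y, f⟩) (δ := ⟨z, z, 𝟙 z⟩) hz, map_zero, zero_smul]
  · simp

/-- The groupoid algebra is a weak Hopf algebra. -/
theorem isWeakHopfAlgebra : IsWeakHopfAlgebra k (GroupoidAlgebra k C) antipode where
  toIsWeakBialgebra := isWeakBialgebra
  antipode_left := by
    refine hom_ext ?_
    rintro ⟨x, y, f⟩
    rw [epsS_arr]
    simp only [LinearMap.comp_apply, comul_arr, LinearMap.rTensor_tmul, LinearMap.mul'_apply,
      antipode, extend_arr, arr_mul_of_eq, Groupoid.comp_inv]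
  antipode_right := by
    refine hom_ext ?_
    rintro ⟨x, y, f⟩
    rw [epsT_arr]
    simp only [LinearMap.comp_apply, comul_arr, LinearMap.lTensor_tmul, LinearMap.mul'_apply,
      antipode, extend_arr, arr_mul_of_eq, Groupoid.inv_comp]
  antipode_mid := by
    refine hom_ext ?_
    rintro ⟨x, y, f⟩
    simp only [LinearMap.comp_apply, comul_arr, LinearMap.lTensor_tmul, LinearMap.mul'_apply,
      antipode, extend_arr, arr_mul_of_eq, Groupoid.inv_comp, TensorProduct.map_tmul,
      Category.id_comp]

end GroupoidAlgebra

end Groupoids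

/-! ## The groupoid `Γ(G)` -/

section Gamma

open CategoryTheory

/-- The set `P_e(G)` of subsets of the finite group `G` that contain the neutral element. -/
@[ext]
structure PE (G : Type u) [Group G] where
  /-- the subset -/
  set : Finset G
  one_mem : (1 : G) ∈ set

instance (G : Type u) [Group G] [Fintype G] [DecidableEq G] : Fintype (PE G) :=
  Fintype.ofEquiv {X : Finset G // (1 : G) ∈ X}
    { toFun := fun X => ⟨X.1, X.2⟩, invFun := fun X => ⟨X.set, X.one_mem⟩,
      left_inv := fun _ => rfl, right_inv := fun _ => rfl }

variable {G : Type u} [Group G] [DecidableEq G]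

/-- The arrows `X ⟶ Y` of `Γ(G)`: the elements `g` with `g⁻¹ ∈ X` and `gX = Y`. Such an arrow is
the pair `(g, X)`. -/
@[ext]
structure PE.Hom (X Y : PE G) where
  /-- the group element -/
  val : G
  inv_mem : val⁻¹ ∈ X.set
  smul_eq : val • X.set = Y.set

/-- The groupoid `Γ(G)`. The composite of `(h, X)` followed by `(g, hX)` is `(gh, X)`, and the
inverse of `(g, X)` is `(g⁻¹, gX)`. -/
instance : Groupoid (PE G) where
  Hom X Y := PE.Hom X Y
  id X := ⟨1, by simpa using X.one_mem, one_smul _ _⟩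
  comp {X Y Z} f g := ⟨g.val * f.val, by
      have h := g.inv_mem
      rw [← f.smul_eq, Finset.mem_smul_finset] at h
      obtain ⟨x, hx, hfx⟩ := h
      rw [smul_eq_mul] at hfx
      rw [mul_inv_rev, ← hfx, inv_mul_cancel_left]
      exact hx, by rw [mul_smul, f.smul_eq, g.smul_eq]⟩
  id_comp f := PE.Hom.ext (mul_one _)
  comp_id f := PE.Hom.ext (one_mul _)
  assoc f g h := PE.Hom.ext (mul_assoc _ _ _).symm
  inv {X Y} f := ⟨f.val⁻¹, by
      rw [inv_inv, ← f.smul_eq, Finset.mem_smul_finset]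
      exact ⟨1, X.one_mem, by simp⟩, by rw [← f.smul_eq, inv_smul_smul]⟩
  inv_comp f := PE.Hom.ext (mul_inv_cancel _)
  comp_inv f := PE.Hom.ext (inv_mul_cancel _)

/-- The translate `gX` for `g⁻¹ ∈ X`. -/
def PE.translate (g : G) (X : PE G) (h : g⁻¹ ∈ X.set) : PE G :=
  ⟨g • X.set, Finset.mem_smul_finset.2 ⟨g⁻¹, h, by simp⟩⟩

/-- The element `(g, X)` of `Γ(G)`, with source `X` and target `gX`. -/
def pair (g : G) (X : PE G) (h : g⁻¹ ∈ X.set) : Arr (PE G) :=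
  ⟨X, X.translate g h, (⟨g, h, rfl⟩ : PE.Hom X (X.translate g h))⟩

/-- Every arrow of `Γ(G)` is of the form `(g, X)`, for a unique pair `(g, X)` with `g⁻¹ ∈ X`. -/
theorem pair_bijective : Function.Bijective
    (fun p : {p : G × PE G // p.1⁻¹ ∈ p.2.set} => pair p.1.1 p.1.2 p.2) := by
  have hval : ∀ {γ δ : Arr (PE G)}, γ = δ → PE.Hom.val γ.hom = PE.Hom.val δ.hom := by
    rintro γ _ rfl
    rfl
  constructor
  · rintro ⟨⟨g, X⟩, h⟩ ⟨⟨g', X'⟩, h'⟩ e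
    have e1 : X = X' := congrArg Arr.src e
    have e2 : g = g' := hval e
    subst e1 e2
    rfl
  · rintro ⟨X, ⟨Y, hY⟩, ⟨g, h1, h2⟩⟩
    obtain rfl : g • X.set = Y := h2
    exact ⟨⟨⟨g, X⟩, h1⟩, rfl⟩

end Gamma

/-! ## The partial group algebra -/

section Partial

variable (k : Type w) [CommRing k] (G : Type u) [Group G]

open FreeAlgebra in
/-- The defining relations of the partial group algebra. -/
inductive PartialRel : FreeAlgebra k G → FreeAlgebra k G → Prop
  | one : PartialRel (ι k 1) 1
  | right (g h : G) : PartialRel (ι k g * ι k h * ι k h⁻¹) (ι k (g * h) * ι k h⁻¹)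
  | left (g h : G) : PartialRel (ι k g⁻¹ * ι k g * ι k h) (ι k g⁻¹ * ι k (g * h))

/-- The partial group algebra `k_par G`. -/
def PartialGroupAlgebra : Type (max u w) := RingQuot (PartialRel k G)

namespace PartialGroupAlgebra

instance : Ring (PartialGroupAlgebra k G) := inferInstanceAs (Ring (RingQuot (PartialRel k G)))

instance : Algebra k (PartialGroupAlgebra k G) :=
  inferInstanceAs (Algebra k (RingQuot (PartialRel k G)))

variable {G}

/-- The quotient map from the free algebra. -/
def mk : FreeAlgebra k G →ₐ[k] PartialGroupAlgebra k G := RingQuot.mkAlgHom k (PartialRel k G)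

/-- The generator `[g]`. -/
def of (g : G) : PartialGroupAlgebra k G := mk k (FreeAlgebra.ι k g)

variable {k}

theorem of_one : of k (1 : G) = 1 :=
  (RingQuot.mkAlgHom_rel k PartialRel.one).trans (map_one _)

theorem of_right (g h : G) : of k g * of k h * of k h⁻¹ = of k (g * h) * of k h⁻¹ := by
  have e : mk k (FreeAlgebra.ι k g * FreeAlgebra.ι k h * FreeAlgebra.ι k h⁻¹) =
      mk k (FreeAlgebra.ι k (g * h) * FreeAlgebra.ι k h⁻¹) :=
    RingQuot.mkAlgHom_rel k (PartialRel.right (k := k) g h)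
  simpa only [of, map_mul] using e

theorem of_left (g h : G) : of k g⁻¹ * of k g * of k h = of k g⁻¹ * of k (g * h) := by
  have e : mk k (FreeAlgebra.ι k g⁻¹ * FreeAlgebra.ι k g * FreeAlgebra.ι k h) =
      mk k (FreeAlgebra.ι k g⁻¹ * FreeAlgebra.ι k (g * h)) :=
    RingQuot.mkAlgHom_rel k (PartialRel.left (k := k) g h)
  simpa only [of, map_mul] using e

/-- The universal property: a partial representation of `G` in `B` extends to an algebra
morphism `k_par G → B`. -/
def lift {B : Type*} [Ring B] [Algebra k B] (π : G → B) (h1 : π 1 = 1)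
    (h2 : ∀ g h, π g * π h * π h⁻¹ = π (g * h) * π h⁻¹)
    (h3 : ∀ g h, π g⁻¹ * π g * π h = π g⁻¹ * π (g * h)) : PartialGroupAlgebra k G →ₐ[k] B :=
  RingQuot.liftAlgHom k ⟨FreeAlgebra.lift k π, by
    rintro _ _ (_ | ⟨g, h⟩ | ⟨g, h⟩)
    · simpa using h1
    · simpa using h2 g h
    · simpa using h3 g h⟩

theorem lift_of {B : Type*} [Ring B] [Algebra k B] (π : G → B) (h1 : π 1 = 1)
    (h2 : ∀ g h, π g * π h * π h⁻¹ = π (g * h) * π h⁻¹)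
    (h3 : ∀ g h, π g⁻¹ * π g * π h = π g⁻¹ * π (g * h)) (g : G) :
    lift (k := k) π h1 h2 h3 (of k g) = π g := by
  refine (RingQuot.liftAlgHom_mkAlgHom_apply k _ _ _).trans ?_
  simp

variable (k) in
/-- The idempotent `ε_g = [g][g⁻¹]`. -/
def eps (g : G) : PartialGroupAlgebra k G := of k g * of k g⁻¹

variable (k G) in
/-- The subalgebra `A_par` generated by the elements `ε_g`. -/
def Apar : Subalgebra k (PartialGroupAlgebra k G) := Algebra.adjoin k (Set.range (eps k))

theorem of_inv_of (g : G) : of k g * of k g⁻¹ * of k g = of k g := by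
  have h := of_right (k := k) g g⁻¹
  rwa [inv_inv, mul_inv_cancel, of_one, one_mul] at h

theorem of_eps (g h : G) : of k g * eps k h = eps k (g * h) * of k g := by
  have h' := of_left (k := k) (g * h)⁻¹ g
  rw [inv_inv, mul_inv_rev, inv_mul_cancel_right] at h'
  rw [eps, eps, ← mul_assoc, of_right, mul_inv_rev, h']

theorem eps_comm (g h : G) : eps k g * eps k h = eps k h * eps k g := by
  conv_lhs => rw [eps, mul_assoc, of_eps, ← mul_assoc, of_eps, mul_inv_cancel_left]
  rw [mul_assoc]
  rfl

theorem eps_mem (g : G) : eps k g ∈ Apar k G := Algebra.subset_adjoin ⟨g, rfl⟩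

theorem Apar_comm_eps {a : PartialGroupAlgebra k G} (ha : a ∈ Apar k G) (g : G) :
    eps k g * a = a * eps k g := by
  induction ha using Algebra.adjoin_induction with
  | mem x hx =>
    obtain ⟨h, rfl⟩ := hx
    exact eps_comm g h
  | algebraMap r => exact (Algebra.commutes r _).symm
  | add x y _ _ hx hy => rw [mul_add, add_mul, hx, hy]
  | mul x y _ _ hx hy => rw [← mul_assoc, hx, mul_assoc, hy, mul_assoc]

theorem conj_mem {a : PartialGroupAlgebra k G} (ha : a ∈ Apar k G) (g : G) :
    of k g * a * of k g⁻¹ ∈ Apar k G := by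
  induction ha using Algebra.adjoin_induction with
  | mem x hx =>
    obtain ⟨h, rfl⟩ := hx
    rw [of_eps, mul_assoc]
    exact mul_mem (eps_mem _) (eps_mem g)
  | algebraMap r =>
    rw [← Algebra.commutes, mul_assoc]
    exact mul_mem (Subalgebra.algebraMap_mem _ r) (eps_mem g)
  | add x y _ _ hx hy =>
    rw [mul_add, add_mul]
    exact add_mem hx hy
  | mul x y hx' _ hx hy =>
    have e : of k g * (x * y) * of k g⁻¹ =
        (of k g * x * of k g⁻¹) * (of k g * y * of k g⁻¹) := by
      have h1 : of k g * eps k g⁻¹ = of k g := by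
        rw [eps, inv_inv, ← mul_assoc, of_inv_of]
      have h2 : of k g * x * eps k g⁻¹ = of k g * x := by
        rw [mul_assoc, ← Apar_comm_eps hx', ← mul_assoc, h1]
      rw [eps, inv_inv] at h2
      calc of k g * (x * y) * of k g⁻¹ = (of k g * x) * y * of k g⁻¹ := by
            simp only [mul_assoc]
        _ = (of k g * x * (of k g⁻¹ * of k g)) * y * of k g⁻¹ := by rw [h2]
        _ = _ := by simp only [mul_assoc]
    rw [e]
    exact mul_mem hx hy

/-- The map `a ↦ [g] a [g⁻¹]` on `A_par`; it maps `ε_{h₁} ⋯ ε_{hₙ}` to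
`ε_{g h₁} ⋯ ε_{g hₙ} ε_g`. -/
def conj (g : G) : Module.End k (Apar k G) where
  toFun a := ⟨of k g * a * of k g⁻¹, conj_mem a.2 g⟩
  map_add' a b := Subtype.ext (by simp [mul_add, add_mul])
  map_smul' r a := Subtype.ext (by simp)

/-- The partial `G`-module `A_par`, as an algebra morphism `k_par G → End(A_par)`. -/
def act : PartialGroupAlgebra k G →ₐ[k] Module.End k (Apar k G) :=
  lift conj
    (LinearMap.ext fun a => Subtype.ext (by simp [conj, of_one]))
    (fun g h => LinearMap.ext fun a => Subtype.ext (by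
      have e1 := of_right (k := k) g h
      have e2 := of_left (k := k) h⁻¹ g⁻¹
      rw [inv_inv] at e2
      simp only [conj, Module.End.mul_apply, LinearMap.coe_mk, AddHom.coe_mk, inv_inv,
        mul_inv_rev, ← mul_assoc] at e1 ⊢
      rw [e1]
      simp only [mul_assoc] at e2 ⊢
      rw [e2]))
    (fun g h => LinearMap.ext fun a => Subtype.ext (by
      have e1 := of_left (k := k) g h
      have e2 := of_right (k := k) h⁻¹ g⁻¹
      rw [inv_inv] at e2
      simp only [conj, Module.End.mul_apply, LinearMap.coe_mk, AddHom.coe_mk, inv_inv,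
        mul_inv_rev, ← mul_assoc] at e1 ⊢
      rw [e1]
      simp only [mul_assoc] at e2 ⊢
      rw [e2]))

/-- The left counit `ε_l(x) = x · 1`, with values
`ε_l([g₁] ⋯ [gₙ]) = ε_{g₁} ε_{g₁g₂} ⋯ ε_{g₁⋯gₙ}`. -/
def counitL : PartialGroupAlgebra k G →ₗ[k] Apar k G :=
  (act (k := k) (G := G)).toLinearMap.flip 1

/-- The antipode as an algebra morphism to the opposite algebra. -/
def antipodeHom : PartialGroupAlgebra k G →ₐ[k] (PartialGroupAlgebra k G)ᵐᵒᵖ :=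
  lift (fun g => MulOpposite.op (of k g⁻¹)) (by simp [of_one])
    (fun g h => by
      have e := of_left (k := k) h⁻¹ g⁻¹
      simp only [← MulOpposite.op_mul, inv_inv, mul_inv_rev] at e ⊢
      rw [← mul_assoc, e])
    (fun g h => by
      have e := of_right (k := k) h⁻¹ g⁻¹
      simp only [← MulOpposite.op_mul, inv_inv, mul_inv_rev] at e ⊢
      rw [← mul_assoc, e])

/-- The antipode, `S([g₁] ⋯ [gₙ]) = [gₙ⁻¹] ⋯ [g₁⁻¹]`. -/
def antipode : PartialGroupAlgebra k G →ₗ[k] PartialGroupAlgebra k G :=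
  (MulOpposite.opLinearEquiv k).symm.toLinearMap ∘ₗ antipodeHom.toLinearMap

/-- The right counit `ε_r = ε_l ∘ S`, with values
`ε_r([g₁] ⋯ [gₙ]) = ε_{gₙ⁻¹} ε_{gₙ⁻¹gₙ₋₁⁻¹} ⋯ ε_{gₙ⁻¹⋯g₁⁻¹}`. -/
def counitR : PartialGroupAlgebra k G →ₗ[k] Apar k G := counitL ∘ₗ antipode

theorem diag_aux_one : of k (1 : G) ⊗ₜ[k] of k (1 : G) = 1 := by
  rw [of_one, Algebra.TensorProduct.one_def]

theorem diag_aux_right (g h : G) :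
    (of k g ⊗ₜ[k] of k g) * (of k h ⊗ₜ[k] of k h) * (of k h⁻¹ ⊗ₜ[k] of k h⁻¹) =
      (of k (g * h) ⊗ₜ[k] of k (g * h)) * (of k h⁻¹ ⊗ₜ[k] of k h⁻¹) := by
  simp only [Algebra.TensorProduct.tmul_mul_tmul, of_right]

theorem diag_aux_left (g h : G) :
    (of k g⁻¹ ⊗ₜ[k] of k g⁻¹) * (of k g ⊗ₜ[k] of k g) * (of k h ⊗ₜ[k] of k h) =
      (of k g⁻¹ ⊗ₜ[k] of k g⁻¹) * (of k (g * h) ⊗ₜ[k] of k (g * h)) := by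
  simp only [Algebra.TensorProduct.tmul_mul_tmul, of_left]

/-- The algebra morphism `k_par G → k_par G ⊗[k] k_par G`, `[g] ↦ [g] ⊗ [g]`. -/
def diag : PartialGroupAlgebra k G →ₐ[k] PartialGroupAlgebra k G ⊗[k] PartialGroupAlgebra k G :=
  lift (fun g => of k g ⊗ₜ[k] of k g) diag_aux_one diag_aux_right diag_aux_left

variable (k G) in
/-- The Hopf algebroid structure maps of `k_par G`, with both base algebras equal to `A_par`: all
source and target maps are the inclusion,
`Δ_l([g₁] ⋯ [gₙ]) = Δ_r([g₁] ⋯ [gₙ]) = [g₁] ⋯ [gₙ] ⊗ [g₁] ⋯ [gₙ]` in the tensor product over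
`A_par`, the counits and the antipode are as above, and the anti-isomorphism between the
(commutative) base algebras is the identity. -/
def hopfAlgebroidData :
    HopfAlgebroidData k (Apar k G) (Apar k G) (PartialGroupAlgebra k G) where
  left :=
    { s := (Apar k G).val.toLinearMap
      t := (Apar k G).val.toLinearMap
      Δ := (leftRel (Apar k G).val.toLinearMap (Apar k G).val.toLinearMap).mkQ ∘ₗ
        diag.toLinearMap
      ε := counitL }
  right :=
    { s := (Apar k G).val.toLinearMap
      t := (Apar k G).val.toLinearMap
      Δ := (rightRel (Apar k G).val.toLinearMap (Apar k G).val.toLinearMap).mkQ ∘ₗ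
        diag.toLinearMap
      ε := counitR }
  θ := LinearMap.id
  S := antipode

theorem diag_of (g : G) : diag (of k g) = of k g ⊗ₜ[k] of k g :=
  lift_of _ diag_aux_one diag_aux_right diag_aux_left g

theorem antipodeHom_of (g : G) : antipodeHom (of k g) = MulOpposite.op (of k g⁻¹) :=
  lift_of _ _ _ _ _

theorem act_of (g : G) : act (of k g) = conj g := lift_of _ _ _ _ _

/-! The values of the structure maps on monomials. -/

theorem diag_monomial (l : List G) :
    diag (l.map (of k)).prod = (l.map (of k)).prod ⊗ₜ[k] (l.map (of k)).prod := by
  induction l with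
  | nil => simp [Algebra.TensorProduct.one_def]
  | cons g l ih =>
    simp only [List.map_cons, List.prod_cons, map_mul, ih]
    rw [diag_of, Algebra.TensorProduct.tmul_mul_tmul]

theorem antipode_monomial (l : List G) :
    antipode (l.map (of k)).prod = (l.reverse.map fun g => of k g⁻¹).prod := by
  change MulOpposite.unop (antipodeHom (l.map (of k)).prod) = _
  induction l with
  | nil => simp
  | cons g l ih =>
    simp only [List.map_cons, List.prod_cons, map_mul, MulOpposite.unop_mul, ih,
      List.reverse_cons, List.map_append, List.prod_append, List.map_nil, List.prod_nil, mul_one]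
    rw [antipodeHom_of, MulOpposite.unop_op]

theorem of_mul_prod_eps (g : G) (L : List G) :
    of k g * (L.map (eps k)).prod = (L.map fun h => eps k (g * h)).prod * of k g := by
  induction L with
  | nil => simp
  | cons h L ih =>
    simp only [List.map_cons, List.prod_cons]
    rw [← mul_assoc, of_eps, mul_assoc, ih, mul_assoc]

theorem prod_eps_mem (f : G → G) (L : List G) : (L.map fun h => eps k (f h)).prod ∈ Apar k G := by
  refine list_prod_mem fun x hx => ?_
  obtain ⟨h, -, rfl⟩ := List.mem_map.1 hx
  exact eps_mem _

theorem counitL_monomial (l : List G) :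
    (counitL (l.map (of k)).prod : PartialGroupAlgebra k G) =
      (l.inits.tail.map fun p => eps k p.prod).prod := by
  induction l with
  | nil => simp [counitL]
  | cons g l ih =>
    have e : (counitL ((g :: l).map (of k)).prod : PartialGroupAlgebra k G) =
        of k g * counitL (l.map (of k)).prod * of k g⁻¹ := by
      change ((act ((g :: l).map (of k)).prod 1 : Apar k G) : PartialGroupAlgebra k G) = _
      rw [List.map_cons, List.prod_cons, map_mul, act_of]
      rfl
    obtain ⟨T, hT⟩ : ∃ T, l.inits = [] :: T := by cases l <;> simp
    rw [e, ih, List.inits_cons, hT]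
    simp only [List.tail_cons, List.map_cons, List.prod_cons, List.prod_nil, mul_one]
    have e3 : (T.map fun p => eps k p.prod) = (T.map List.prod).map (eps k) := by simp
    rw [e3, of_mul_prod_eps, mul_assoc]
    change _ * eps k g = _
    rw [← Apar_comm_eps (prod_eps_mem _ _), List.map_map, List.map_map]
    congr 2

theorem counitR_monomial (l : List G) :
    (counitR (l.map (of k)).prod : PartialGroupAlgebra k G) =
      ((l.reverse.map (·⁻¹)).inits.tail.map fun p => eps k p.prod).prod := by
  rw [counitR, LinearMap.comp_apply, antipode_monomial, ← counitL_monomial, List.map_map]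
  rfl

end PartialGroupAlgebra

end Partial

end ParHopf

end

open scoped TensorProduct Pointwise

noncomputable section

/-! Both algebras have the same shape, recorded in `IsDiagonal`. They are spanned by a
multiplicatively closed set `M` of group-like elements, an anti-multiplicative `S` satisfies `m * S
m * m = m` on `M`, and a commutative subalgebra `A` is spanned by idempotents of `M` and stable
under `a ↦ m * a * S m`. For the partial group algebra `M` consists of the monomials. For the
groupoid algebra it consists of the arrows together with `0`, and `A` is the span of the identity
arrows, which is both `H_t` and `H_s`; there the target maps and the anti-isomorphism are plain
inclusions as well.

In this setting every Hopf algebroid law is a linear identity that can be checked on `M`, with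
counits `m * S m` and `S m * m`. The only real difficulty is that the laws speak of arbitrary
representatives of `Δ h` in `H ⊗[k] H`, so each map must be seen to respect the balancing relations.
This rests on `IsBaseLinear`: although `a ↦ a ⊗ a` is not linear, an idempotent `e` has `e ⊗ e ≡ 1 ⊗
e` modulo balancing, so `δ (e * m) ≡ (1 ⊗ e) * δ m`. Moreover `m * a = b * m` with `b = m * a * S m`
in `A`, so elements of `A` pass from one side of `m` to the other (`exists_move_left`,
`exists_move_right`).

The algebra isomorphism comes from the atoms `P_X` of the Boolean algebra generated by the commuting
idempotents `ε_g`. They sum to `1`, and `P_X = 0` unless `1 ∈ X`. The sums of arrows `(g, X)` over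
`X` form a partial representation, so the universal property gives `λ`, and `λ` sends `P_X` to the
identity arrow at `X`. The linear map `(g, X) ↦ [g] P_X` is a right inverse of `λ`; its image is a
left ideal containing `1`, hence everything, so `λ` is bijective.

For the coproducts it suffices to treat the generators: in `λ[g] ⊗ λ[g]` the mixed terms `(g, X) ⊗
(g, Y)` vanish after balancing, because their targets (on the left) or sources (on the right)
differ. Compatibility with the counits then follows from the antipode laws
(`isHopfAlgebroidIso_of`). -/

namespace ParHopf

universe u v w

/-! ### Algebras spanned by group-like partial isometries, and their Hopf algebroid structure. -/

section Diagonal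

variable {k : Type*} [CommRing k] {H : Type*} [Ring H] [Algebra k H]

/-- An algebra `H` spanned by a multiplicative set `M` of group-like elements, which are partial
isometries for the anti-multiplicative map `S`, with a commutative subalgebra `A` spanned by
idempotents from `M`. -/
structure IsDiagonal (A : Subalgebra k H) (δ : H →ₗ[k] H ⊗[k] H) (S : H →ₗ[k] H)
    (M : Set H) : Prop where
  span_eq : Submodule.span k M = ⊤
  mul_mem : ∀ m ∈ M, ∀ n ∈ M, m * n ∈ M
  comul_mul : ∀ g h, δ (g * h) = δ g * δ h
  comul_mem : ∀ m ∈ M, δ m = m ⊗ₜ[k] m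
  comm : ∀ a ∈ A, ∀ b ∈ A, a * b = b * a
  base_le : ∀ a ∈ A, a ∈ Submodule.span k {e | e ∈ M ∧ e ∈ A ∧ e * e = e}
  S_one : S 1 = 1
  S_mul : ∀ g h, S (g * h) = S h * S g
  S_base : ∀ a ∈ A, S a = a
  S_mem : ∀ m ∈ M, S m ∈ M
  S_S : ∀ m ∈ M, S (S m) = m
  mul_S_mul : ∀ m ∈ M, m * S m * m = m
  conj_mem : ∀ m ∈ M, ∀ a ∈ A, m * a * S m ∈ A

/-- The relations of the tensor product balanced over the subalgebra `A` acting on the left. -/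
abbrev leftBal (A : Subalgebra k H) : Submodule k (H ⊗[k] H) :=
  leftRel A.val.toLinearMap A.val.toLinearMap

/-- The relations of the tensor product balanced over the subalgebra `A` acting on the right. -/
abbrev rightBal (A : Subalgebra k H) : Submodule k (H ⊗[k] H) :=
  rightRel A.val.toLinearMap A.val.toLinearMap

/-- Left bialgebroid data with the inclusion of `A` as source and target. -/
def leftDiag (A : Subalgebra k H) (δ : H →ₗ[k] H ⊗[k] H) (ε : H →ₗ[k] A) :
    LeftBialgebroidData k A H where
  s := A.val.toLinearMap
  t := A.val.toLinearMap
  Δ := (leftBal A).mkQ ∘ₗ δ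
  ε := ε

/-- Right bialgebroid data with the inclusion of `A` as source and target. -/
def rightDiag (A : Subalgebra k H) (δ : H →ₗ[k] H ⊗[k] H) (ε : H →ₗ[k] A) :
    RightBialgebroidData k A H where
  s := A.val.toLinearMap
  t := A.val.toLinearMap
  Δ := (rightBal A).mkQ ∘ₗ δ
  ε := ε

/-- The tool for replacing an arbitrary representative `x` of `Δ h` by `δ h`: only the generating
relations have to be checked. -/
theorem leftBal_congr {A : Subalgebra k H} {N : Type*} [AddCommGroup N] [Module k N]
    (f : H ⊗[k] H →ₗ[k] N) (hf : ∀ a ∈ A, ∀ g h, f ((a * g) ⊗ₜ h) = f (g ⊗ₜ (a * h)))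
    {x y : H ⊗[k] H} (hxy : (leftBal A).mkQ x = (leftBal A).mkQ y) : f x = f y := by
  have hle : leftBal A ≤ LinearMap.ker f := by
    refine Submodule.span_le.2 ?_
    rintro _ ⟨a, g, h, rfl⟩
    simpa [sub_eq_zero] using hf a a.2 g h
  have h2 := hle ((Submodule.Quotient.eq _).1 hxy)
  rwa [LinearMap.mem_ker, map_sub, sub_eq_zero] at h2

theorem rightBal_congr {A : Subalgebra k H} {N : Type*} [AddCommGroup N] [Module k N]
    (f : H ⊗[k] H →ₗ[k] N) (hf : ∀ a ∈ A, ∀ g h, f ((g * a) ⊗ₜ h) = f (g ⊗ₜ (h * a)))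
    {x y : H ⊗[k] H} (hxy : (rightBal A).mkQ x = (rightBal A).mkQ y) : f x = f y := by
  have hle : rightBal A ≤ LinearMap.ker f := by
    refine Submodule.span_le.2 ?_
    rintro _ ⟨a, g, h, rfl⟩
    simpa [sub_eq_zero] using hf a a.2 g h
  have h2 := hle ((Submodule.Quotient.eq _).1 hxy)
  rwa [LinearMap.mem_ker, map_sub, sub_eq_zero] at h2

theorem leftBal_bal {A : Subalgebra k H} {a : H} (ha : a ∈ A) (g h : H) :
    (leftBal A).mkQ ((a * g) ⊗ₜ h) = (leftBal A).mkQ (g ⊗ₜ (a * h)) :=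
  (Submodule.Quotient.eq _).2 (Submodule.subset_span ⟨⟨a, ha⟩, g, h, rfl⟩)

theorem rightBal_bal {A : Subalgebra k H} {a : H} (ha : a ∈ A) (g h : H) :
    (rightBal A).mkQ ((g * a) ⊗ₜ h) = (rightBal A).mkQ (g ⊗ₜ (h * a)) :=
  (Submodule.Quotient.eq _).2 (Submodule.subset_span ⟨⟨a, ha⟩, g, h, rfl⟩)

/-- Balancing takes place on the left of each factor, so multiplication on the right by any `z` is
harmless. Multiplication on the left is well defined only for special elements. -/
theorem leftBal_mul_right {A : Subalgebra k H} {x y : H ⊗[k] H}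
    (hxy : (leftBal A).mkQ x = (leftBal A).mkQ y) (z : H ⊗[k] H) :
    (leftBal A).mkQ (x * z) = (leftBal A).mkQ (y * z) := by
  refine leftBal_congr ((leftBal A).mkQ ∘ₗ LinearMap.mulRight k z) (fun a ha g h => ?_) hxy
  simp only [LinearMap.comp_apply, LinearMap.mulRight_apply]
  induction z with
  | zero => simp
  | add u v hu hv => simp only [mul_add, map_add, hu, hv]
  | tmul u v =>
    simp only [Algebra.TensorProduct.tmul_mul_tmul, mul_assoc]
    exact leftBal_bal ha _ _

theorem rightBal_mul_left {A : Subalgebra k H} {x y : H ⊗[k] H}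
    (hxy : (rightBal A).mkQ x = (rightBal A).mkQ y) (z : H ⊗[k] H) :
    (rightBal A).mkQ (z * x) = (rightBal A).mkQ (z * y) := by
  refine rightBal_congr ((rightBal A).mkQ ∘ₗ LinearMap.mulLeft k z) (fun a ha g h => ?_) hxy
  simp only [LinearMap.comp_apply, LinearMap.mulLeft_apply]
  induction z with
  | zero => simp
  | add u v hu hv => simp only [add_mul, map_add, hu, hv]
  | tmul u v =>
    simp only [Algebra.TensorProduct.tmul_mul_tmul, ← mul_assoc]
    exact rightBal_bal ha _ _

/-- Modulo `R`, the map `δ` is linear over `A` on each side and in each tensor factor. -/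
structure IsBaseLinear (A : Subalgebra k H) (δ : H →ₗ[k] H ⊗[k] H)
    (R : Submodule k (H ⊗[k] H)) : Prop where
  mul_left_fst : ∀ a ∈ A, ∀ h, R.mkQ (δ (a * h)) = R.mkQ ((a ⊗ₜ 1) * δ h)
  mul_left_snd : ∀ a ∈ A, ∀ h, R.mkQ (δ (a * h)) = R.mkQ ((1 ⊗ₜ a) * δ h)
  mul_right_fst : ∀ a ∈ A, ∀ h, R.mkQ (δ (h * a)) = R.mkQ (δ h * (a ⊗ₜ 1))
  mul_right_snd : ∀ a ∈ A, ∀ h, R.mkQ (δ (h * a)) = R.mkQ (δ h * (1 ⊗ₜ a))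

namespace IsDiagonal

variable {A : Subalgebra k H} {δ : H →ₗ[k] H ⊗[k] H} {S : H →ₗ[k] H} {M : Set H}

theorem linearMap_ext (P : IsDiagonal A δ S M) {N : Type*} [AddCommGroup N] [Module k N]
    {f g : H →ₗ[k] N} (h : ∀ m ∈ M, f m = g m) (x : H) : f x = g x :=
  LinearMap.congr_fun (LinearMap.ext_on P.span_eq h) x

theorem base_ext (P : IsDiagonal A δ S M) {N : Type*} [AddCommGroup N] [Module k N]
    {f g : H →ₗ[k] N} (h : ∀ e ∈ M, e ∈ A → e * e = e → f e = g e) {a : H} (ha : a ∈ A) :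
    f a = g a :=
  LinearMap.eqOn_span (fun e he => h e he.1 he.2.1 he.2.2) (P.base_le a ha)

/-- The element of `A` is tested only on idempotents `e` in `M`: then `e * m` lies in `M` again, so
its coproduct is known, and `e * e = e` is available. -/
theorem bilinear_ext (P : IsDiagonal A δ S M) {N : Type*} [AddCommGroup N] [Module k N]
    {f g : H →ₗ[k] H →ₗ[k] N}
    (h : ∀ e ∈ M, e ∈ A → e * e = e → ∀ m ∈ M, f e m = g e m) {a : H} (ha : a ∈ A) (x : H) :
    f a x = g a x := by
  have h1 : f a = g a := P.base_ext (fun e he hA hi => by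
    ext x
    exact P.linearMap_ext (f := f e) (g := g e) (h e he hA hi) x) ha
  rw [h1]

/-- Since `S m * m` lies in the commutative `A`, `m * a = m * (S m * m) * a = (m * a * S m) * m`. -/
theorem exists_move_left (P : IsDiagonal A δ S M) {m a : H} (hm : m ∈ M) (ha : a ∈ A) :
    ∃ b ∈ A, m * a = b * m := by
  have h1 : S m * m ∈ A := by
    simpa [P.S_S m hm] using P.conj_mem _ (P.S_mem m hm) 1 (one_mem A)
  refine ⟨_, P.conj_mem m hm a ha, ?_⟩
  conv_lhs => rw [← P.mul_S_mul m hm]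
  rw [mul_assoc m (S m), mul_assoc m (S m * m), P.comm _ h1 _ ha]
  simp only [mul_assoc]

theorem exists_move_right (P : IsDiagonal A δ S M) {m a : H} (hm : m ∈ M) (ha : a ∈ A) :
    ∃ b ∈ A, a * m = m * b := by
  have h1 : m * S m ∈ A := by
    simpa using P.conj_mem _ hm 1 (one_mem A)
  have h2 := P.conj_mem (S m) (P.S_mem m hm) a ha
  rw [P.S_S m hm] at h2
  refine ⟨_, h2, ?_⟩
  conv_lhs => rw [← P.mul_S_mul m hm]
  rw [← mul_assoc, P.comm _ ha _ h1]
  simp only [mul_assoc]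

/-- To check base-linearity it suffices to consider idempotents and group-like elements. -/
theorem isBaseLinear_of (P : IsDiagonal A δ S M) {R : Submodule k (H ⊗[k] H)}
    (h1 : ∀ m ∈ M, ∀ a ∈ A, R.mkQ ((a * m) ⊗ₜ m) = R.mkQ (m ⊗ₜ (a * m)))
    (h2 : ∀ m ∈ M, ∀ a ∈ A, R.mkQ ((m * a) ⊗ₜ m) = R.mkQ (m ⊗ₜ (m * a)))
    (h3 : ∀ m ∈ M, ∀ a ∈ A, R.mkQ ((a * m) ⊗ₜ (a * m)) = R.mkQ (m ⊗ₜ (a * (a * m))))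
    (h4 : ∀ m ∈ M, ∀ a ∈ A, R.mkQ ((m * a) ⊗ₜ (m * a)) = R.mkQ (m ⊗ₜ (m * a * a))) :
    IsBaseLinear A δ R := by
  have l2 : ∀ a ∈ A, ∀ h, R.mkQ (δ (a * h)) = R.mkQ ((1 ⊗ₜ a) * δ h) := by
    intro a ha h
    refine P.bilinear_ext
      (f := (LinearMap.mul k H).compr₂ (R.mkQ ∘ₗ δ))
      (g := (((LinearMap.mul k (H ⊗[k] H)).compr₂ R.mkQ) ∘ₗ
        TensorProduct.mk k H H 1).compl₂ δ) (fun e he hA hi m hm => ?_) ha h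
    simp only [LinearMap.compr₂_apply, LinearMap.mul_apply', LinearMap.comp_apply,
      LinearMap.compl₂_apply, TensorProduct.mk_apply]
    -- The coproduct of `e * m` is quadratic in `e`. After `h3` both copies of `e` stand in the
    -- second factor, where idempotence merges them into one.
    rw [P.comul_mem _ (P.mul_mem e he m hm), P.comul_mem m hm, h3 m hm e hA,
      Algebra.TensorProduct.tmul_mul_tmul, one_mul, ← mul_assoc, hi]
  have r2 : ∀ a ∈ A, ∀ h, R.mkQ (δ (h * a)) = R.mkQ (δ h * (1 ⊗ₜ a)) := by
    intro a ha h
    refine P.bilinear_ext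
      (f := (LinearMap.mul k H).flip.compr₂ (R.mkQ ∘ₗ δ))
      (g := (((LinearMap.mul k (H ⊗[k] H)).flip.compr₂ R.mkQ) ∘ₗ
        TensorProduct.mk k H H 1).compl₂ δ) (fun e he hA hi m hm => ?_) ha h
    simp only [LinearMap.compr₂_apply, LinearMap.mul_apply', LinearMap.comp_apply,
      LinearMap.compl₂_apply, TensorProduct.mk_apply, LinearMap.flip_apply]
    rw [P.comul_mem _ (P.mul_mem m hm e he), P.comul_mem m hm, h4 m hm e hA,
      Algebra.TensorProduct.tmul_mul_tmul, mul_one, mul_assoc, hi]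
  refine ⟨fun a ha h => (l2 a ha h).trans ?_, l2, fun a ha h => (r2 a ha h).trans ?_, r2⟩
  · refine P.linearMap_ext (f := R.mkQ ∘ₗ LinearMap.mulLeft k (1 ⊗ₜ a) ∘ₗ δ)
      (g := R.mkQ ∘ₗ LinearMap.mulLeft k (a ⊗ₜ 1) ∘ₗ δ) (fun m hm => ?_) h
    simp only [LinearMap.comp_apply, LinearMap.mulLeft_apply]
    rw [P.comul_mem m hm, Algebra.TensorProduct.tmul_mul_tmul,
      Algebra.TensorProduct.tmul_mul_tmul, one_mul, h1 m hm a ha]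
  · refine P.linearMap_ext (f := R.mkQ ∘ₗ LinearMap.mulRight k (1 ⊗ₜ a) ∘ₗ δ)
      (g := R.mkQ ∘ₗ LinearMap.mulRight k (a ⊗ₜ 1) ∘ₗ δ) (fun m hm => ?_) h
    simp only [LinearMap.comp_apply, LinearMap.mulRight_apply]
    rw [P.comul_mem m hm, Algebra.TensorProduct.tmul_mul_tmul,
      Algebra.TensorProduct.tmul_mul_tmul, mul_one, h2 m hm a ha]

/-- Multiplication by `A` on the left is balanced by definition. On the right, `m * a` is rewritten
as `b * m`, balanced, and rewritten back. -/
theorem isBaseLinear_leftBal (P : IsDiagonal A δ S M) : IsBaseLinear A δ (leftBal A) := by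
  refine P.isBaseLinear_of (fun m _ a ha => leftBal_bal ha _ _) (fun m hm a ha => ?_)
    (fun m _ a ha => leftBal_bal ha _ _) (fun m hm a ha => ?_)
  all_goals
    obtain ⟨b, hb, e⟩ := P.exists_move_left hm ha
    conv_lhs => rw [e]
    rw [leftBal_bal hb]
  · rw [e]
  · rw [← e, ← mul_assoc, ← e]

theorem isBaseLinear_rightBal (P : IsDiagonal A δ S M) : IsBaseLinear A δ (rightBal A) := by
  refine P.isBaseLinear_of (fun m hm a ha => ?_) (fun m _ a ha => rightBal_bal ha _ _)
    (fun m hm a ha => ?_) (fun m _ a ha => rightBal_bal ha _ _)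
  all_goals
    obtain ⟨b, hb, e⟩ := P.exists_move_right hm ha
    conv_lhs => rw [e]
    rw [rightBal_bal hb]
  · rw [e]
  · rw [← e, mul_assoc, ← e]

/-- The unit need not belong to `M`: in a groupoid algebra it is a sum of identity arrows. It does
belong to `A`, so it suffices that `δ a` and `a ⊗ 1` agree modulo `R` on the idempotents spanning
`A`. -/
theorem comul_one_of (P : IsDiagonal A δ S M) {R : Submodule k (H ⊗[k] H)}
    (h : ∀ e ∈ M, e ∈ A → e * e = e → R.mkQ (e ⊗ₜ e) = R.mkQ (e ⊗ₜ 1)) :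
    R.mkQ (1 ⊗ₜ[k] 1) = R.mkQ (δ 1) :=
  (P.base_ext (f := R.mkQ ∘ₗ δ) (g := R.mkQ ∘ₗ (TensorProduct.mk k H H).flip 1)
    (fun e he hA hi => by
      simp only [LinearMap.comp_apply, LinearMap.flip_apply, TensorProduct.mk_apply]
      rw [P.comul_mem e he, h e he hA hi]) (one_mem A)).symm

/-! ### Coassociativity -/

/-- Once independence of the representatives is granted, both sides send a group-like `m` to the
class of `m ⊗ m ⊗ m`. -/
theorem mixedCoassoc_of (P : IsDiagonal A δ S M) {R₁ R₂ : Submodule k (H ⊗[k] H)}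
    (h1 : ∀ x h, R₂.mkQ x = R₂.mkQ (δ h) →
      tripleOfLeft R₁ R₂ ((R₁.mkQ ∘ₗ δ).rTensor H x) =
        tripleOfLeft R₁ R₂ ((R₁.mkQ ∘ₗ δ).rTensor H (δ h)))
    (h2 : ∀ y h, R₁.mkQ y = R₁.mkQ (δ h) →
      tripleOfRight R₁ R₂ ((R₂.mkQ ∘ₗ δ).lTensor H y) =
        tripleOfRight R₁ R₂ ((R₂.mkQ ∘ₗ δ).lTensor H (δ h))) :
    MixedCoassoc (R₁.mkQ ∘ₗ δ) (R₂.mkQ ∘ₗ δ) := by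
  intro h x y hx hy
  rw [h1 x h hx, h2 y h hy]
  refine P.linearMap_ext (f := tripleOfLeft R₁ R₂ ∘ₗ (R₁.mkQ ∘ₗ δ).rTensor H ∘ₗ δ)
    (g := tripleOfRight R₁ R₂ ∘ₗ (R₂.mkQ ∘ₗ δ).lTensor H ∘ₗ δ) (fun m hm => ?_) h
  simp only [LinearMap.comp_apply]
  rw [P.comul_mem m hm]
  simp only [LinearMap.rTensor_tmul, LinearMap.lTensor_tmul, LinearMap.comp_apply]
  rw [P.comul_mem m hm, tripleOfLeft_tmul, tripleOfRight_tmul]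

theorem tripleOfLeft_mk (R₁ R₂ : Submodule k (H ⊗[k] H)) (x : H ⊗[k] H) (c : H) :
    tripleOfLeft R₁ R₂ (R₁.mkQ x ⊗ₜ c) =
      (tripleRel R₁ R₂).mkQ (TensorProduct.assoc k H H H (x ⊗ₜ c)) := by
  simp [tripleOfLeft]

theorem tripleOfRight_mk (R₁ R₂ : Submodule k (H ⊗[k] H)) (x : H ⊗[k] H) (c : H) :
    tripleOfRight R₁ R₂ (c ⊗ₜ R₂.mkQ x) = (tripleRel R₁ R₂).mkQ (c ⊗ₜ x) := by
  simp [tripleOfRight]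

theorem tripleRel_mk_tmul_congr {R₁ R₂ : Submodule k (H ⊗[k] H)} {x y : H ⊗[k] H}
    (h : R₂.mkQ x = R₂.mkQ y) (c : H) :
    (tripleRel R₁ R₂).mkQ (c ⊗ₜ x) = (tripleRel R₁ R₂).mkQ (c ⊗ₜ y) := by
  rw [← tripleOfRight_mk, h, tripleOfRight_mk]

theorem tripleRel_mk_assoc_congr {R₁ R₂ : Submodule k (H ⊗[k] H)} {x y : H ⊗[k] H}
    (h : R₁.mkQ x = R₁.mkQ y) (c : H) :
    (tripleRel R₁ R₂).mkQ (TensorProduct.assoc k H H H (x ⊗ₜ c)) =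
      (tripleRel R₁ R₂).mkQ (TensorProduct.assoc k H H H (y ⊗ₜ c)) := by
  rw [← tripleOfLeft_mk, h, tripleOfLeft_mk]

/-- `δ ⊗ id` respects the second balancing because `a` can be placed on the second leg of `δ (a *
g)`, next to the factor with which it is exchanged. Only base-linearity modulo `R₁` is used, so the
same lemma serves both the pure and the mixed coassociativity laws. The three variants below differ
in the side of multiplication and in the adjacent leg. -/
theorem tripleOfLeft_leftBal {R₁ : Submodule k (H ⊗[k] H)} (hR : IsBaseLinear A δ R₁)
    {x y : H ⊗[k] H} (hxy : (leftBal A).mkQ x = (leftBal A).mkQ y) :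
    tripleOfLeft R₁ (leftBal A) ((R₁.mkQ ∘ₗ δ).rTensor H x) =
      tripleOfLeft R₁ (leftBal A) ((R₁.mkQ ∘ₗ δ).rTensor H y) := by
  refine leftBal_congr (tripleOfLeft R₁ (leftBal A) ∘ₗ (R₁.mkQ ∘ₗ δ).rTensor H)
    (fun a ha g h => ?_) hxy
  simp only [LinearMap.comp_apply, LinearMap.rTensor_tmul]
  rw [hR.mul_left_snd a ha, tripleOfLeft_mk, tripleOfLeft_mk]
  generalize δ g = z
  induction z with
  | zero => simp
  | add u v hu hv => simp only [mul_add, TensorProduct.add_tmul, map_add, hu, hv]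
  | tmul u v =>
    simp only [Algebra.TensorProduct.tmul_mul_tmul, one_mul, TensorProduct.assoc_tmul]
    exact tripleRel_mk_tmul_congr (leftBal_bal ha _ _) _

theorem tripleOfLeft_rightBal {R₁ : Submodule k (H ⊗[k] H)} (hR : IsBaseLinear A δ R₁)
    {x y : H ⊗[k] H} (hxy : (rightBal A).mkQ x = (rightBal A).mkQ y) :
    tripleOfLeft R₁ (rightBal A) ((R₁.mkQ ∘ₗ δ).rTensor H x) =
      tripleOfLeft R₁ (rightBal A) ((R₁.mkQ ∘ₗ δ).rTensor H y) := by
  refine rightBal_congr (tripleOfLeft R₁ (rightBal A) ∘ₗ (R₁.mkQ ∘ₗ δ).rTensor H)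
    (fun a ha g h => ?_) hxy
  simp only [LinearMap.comp_apply, LinearMap.rTensor_tmul]
  rw [hR.mul_right_snd a ha, tripleOfLeft_mk, tripleOfLeft_mk]
  generalize δ g = z
  induction z with
  | zero => simp
  | add u v hu hv => simp only [add_mul, TensorProduct.add_tmul, map_add, hu, hv]
  | tmul u v =>
    simp only [Algebra.TensorProduct.tmul_mul_tmul, mul_one, TensorProduct.assoc_tmul]
    exact tripleRel_mk_tmul_congr (rightBal_bal ha _ _) _

theorem tripleOfRight_leftBal {R₂ : Submodule k (H ⊗[k] H)} (hR : IsBaseLinear A δ R₂)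
    {x y : H ⊗[k] H} (hxy : (leftBal A).mkQ x = (leftBal A).mkQ y) :
    tripleOfRight (leftBal A) R₂ ((R₂.mkQ ∘ₗ δ).lTensor H x) =
      tripleOfRight (leftBal A) R₂ ((R₂.mkQ ∘ₗ δ).lTensor H y) := by
  refine leftBal_congr (tripleOfRight (leftBal A) R₂ ∘ₗ (R₂.mkQ ∘ₗ δ).lTensor H)
    (fun a ha g h => ?_) hxy
  simp only [LinearMap.comp_apply, LinearMap.lTensor_tmul]
  rw [hR.mul_left_fst a ha, tripleOfRight_mk, tripleOfRight_mk]
  generalize δ h = z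
  induction z with
  | zero => simp
  | add u v hu hv => simp only [mul_add, TensorProduct.tmul_add, map_add, hu, hv]
  | tmul u v =>
    simp only [Algebra.TensorProduct.tmul_mul_tmul, one_mul]
    exact tripleRel_mk_assoc_congr (leftBal_bal ha g u) v

theorem tripleOfRight_rightBal {R₂ : Submodule k (H ⊗[k] H)} (hR : IsBaseLinear A δ R₂)
    {x y : H ⊗[k] H} (hxy : (rightBal A).mkQ x = (rightBal A).mkQ y) :
    tripleOfRight (rightBal A) R₂ ((R₂.mkQ ∘ₗ δ).lTensor H x) =
      tripleOfRight (rightBal A) R₂ ((R₂.mkQ ∘ₗ δ).lTensor H y) := by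
  refine rightBal_congr (tripleOfRight (rightBal A) R₂ ∘ₗ (R₂.mkQ ∘ₗ δ).lTensor H)
    (fun a ha g h => ?_) hxy
  simp only [LinearMap.comp_apply, LinearMap.lTensor_tmul]
  rw [hR.mul_right_fst a ha, tripleOfRight_mk, tripleOfRight_mk]
  generalize δ h = z
  induction z with
  | zero => simp
  | add u v hu hv => simp only [add_mul, TensorProduct.tmul_add, map_add, hu, hv]
  | tmul u v =>
    simp only [Algebra.TensorProduct.tmul_mul_tmul, mul_one]
    exact tripleRel_mk_assoc_congr (rightBal_bal ha g u) v

/-! ### Counits and bialgebroid laws -/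

theorem idempotent_mul_S (P : IsDiagonal A δ S M) {e : H} (hA : e ∈ A) (hi : e * e = e) :
    e * S e = e := by rw [P.S_base e hA, hi]

theorem counitL_base (P : IsDiagonal A δ S M) {ε : H →ₗ[k] A}
    (hε : ∀ m ∈ M, (ε m : H) = m * S m) {a : H} (ha : a ∈ A) : (ε a : H) = a :=
  P.base_ext (f := A.val.toLinearMap ∘ₗ ε) (g := LinearMap.id)
    (fun e he hA hi => (hε e he).trans (P.idempotent_mul_S hA hi)) ha

/-- On an idempotent `e` of `A`, where `S e = e`, the counit is `e * e = e`. -/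
theorem counitR_base (P : IsDiagonal A δ S M) {ε : H →ₗ[k] A}
    (hε : ∀ m ∈ M, (ε m : H) = S m * m) {a : H} (ha : a ∈ A) : (ε a : H) = a :=
  P.base_ext (f := A.val.toLinearMap ∘ₗ ε) (g := LinearMap.id)
    (fun e he hA hi => (hε e he).trans (by simp [P.S_base e hA, hi])) ha

theorem counitL_mul (P : IsDiagonal A δ S M) {ε : H →ₗ[k] A}
    (hε : ∀ m ∈ M, (ε m : H) = m * S m) {a : H} (ha : a ∈ A) (h : H) :
    (ε (a * h) : H) = a * ε h := by
  refine P.bilinear_ext (f := (LinearMap.mul k H).compr₂ (A.val.toLinearMap ∘ₗ ε))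
    (g := (LinearMap.mul k H).compl₂ (A.val.toLinearMap ∘ₗ ε)) (fun e he hA hi m hm => ?_) ha h
  have h1 : m * S m ∈ A := by simpa using P.conj_mem _ hm 1 (one_mem A)
  change (ε (e * m) : H) = e * ε m
  rw [hε _ (P.mul_mem e he m hm), hε m hm, P.S_mul, P.S_base e hA, ← mul_assoc, mul_assoc e m,
    mul_assoc e, P.comm _ h1 _ hA, ← mul_assoc, hi]

theorem counitR_mul (P : IsDiagonal A δ S M) {ε : H →ₗ[k] A}
    (hε : ∀ m ∈ M, (ε m : H) = S m * m) {a : H} (ha : a ∈ A) (h : H) :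
    (ε (h * a) : H) = ε h * a := by
  refine P.bilinear_ext (f := (LinearMap.mul k H).flip.compr₂ (A.val.toLinearMap ∘ₗ ε))
    (g := (LinearMap.mul k H).flip.compl₂ (A.val.toLinearMap ∘ₗ ε))
    (fun e he hA hi m hm => ?_) ha h
  have h1 : S m * m ∈ A := by
    simpa [P.S_S m hm] using P.conj_mem _ (P.S_mem m hm) 1 (one_mem A)
  change (ε (m * e) : H) = ε m * e
  rw [hε _ (P.mul_mem m hm e he), hε m hm, P.S_mul, P.S_base e hA, ← mul_assoc, mul_assoc e,
    ← P.comm _ h1 _ hA, mul_assoc, hi]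

/-- For `m`, `n` in `M` both sides are `m * n * S n * S m`: the projection `n * S n` is fixed by `S`
and idempotent. -/
theorem counitL_mul_counit (P : IsDiagonal A δ S M) {ε : H →ₗ[k] A}
    (hε : ∀ m ∈ M, (ε m : H) = m * S m) (g h : H) : ε (g * h) = ε (g * ε h) := by
  have key : (LinearMap.mul k H).compr₂ ε =
      ((LinearMap.mul k H).compr₂ ε).compl₂ (A.val.toLinearMap ∘ₗ ε) := by
    refine LinearMap.ext_on P.span_eq fun m hm => LinearMap.ext_on P.span_eq fun n hn => ?_
    refine Subtype.ext ?_
    have hn' := P.mul_mem n hn _ (P.S_mem n hn)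
    change (ε (m * n) : H) = ε (m * ε n)
    rw [hε _ (P.mul_mem m hm n hn), hε n hn, hε _ (P.mul_mem m hm _ hn')]
    simp only [P.S_mul, P.S_S n hn]
    simp only [← mul_assoc]
    rw [mul_assoc m n (S n), mul_assoc m (n * S n) n, P.mul_S_mul n hn, mul_assoc m n]
  exact LinearMap.congr_fun (LinearMap.congr_fun key g) h

theorem counitR_mul_counit (P : IsDiagonal A δ S M) {ε : H →ₗ[k] A}
    (hε : ∀ m ∈ M, (ε m : H) = S m * m) (g h : H) : ε (g * h) = ε (ε g * h) := by
  have key : (LinearMap.mul k H).compr₂ ε =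
      ((LinearMap.mul k H).compr₂ ε) ∘ₗ (A.val.toLinearMap ∘ₗ ε) := by
    refine LinearMap.ext_on P.span_eq fun m hm => LinearMap.ext_on P.span_eq fun n hn => ?_
    refine Subtype.ext ?_
    have hm' := P.mul_mem _ (P.S_mem m hm) m hm
    change (ε (m * n) : H) = ε (ε m * n)
    rw [hε _ (P.mul_mem m hm n hn), hε m hm, hε _ (P.mul_mem _ hm' n hn)]
    simp only [P.S_mul, P.S_S m hm]
    simp only [mul_assoc]
    rw [← mul_assoc m (S m) (m * n), ← mul_assoc (m * S m), P.mul_S_mul m hm]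
  exact LinearMap.congr_fun (LinearMap.congr_fun key g) h

/-- Here commutativity of `A` lets the balanced element pass `a` and `b`. -/
theorem leftBal_mul_tmul (P : IsDiagonal A δ S M) {a b : H} (ha : a ∈ A) (hb : b ∈ A)
    {x y : H ⊗[k] H} (hxy : (leftBal A).mkQ x = (leftBal A).mkQ y) :
    (leftBal A).mkQ ((a ⊗ₜ b) * x) = (leftBal A).mkQ ((a ⊗ₜ b) * y) := by
  refine leftBal_congr ((leftBal A).mkQ ∘ₗ LinearMap.mulLeft k (a ⊗ₜ b))
    (fun c hc g h => ?_) hxy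
  simp only [LinearMap.comp_apply, LinearMap.mulLeft_apply, Algebra.TensorProduct.tmul_mul_tmul]
  rw [← mul_assoc a, ← mul_assoc b, P.comm a ha c hc, P.comm b hb c hc, mul_assoc, mul_assoc,
    leftBal_bal hc]

theorem rightBal_mul_tmul (P : IsDiagonal A δ S M) {a b : H} (ha : a ∈ A) (hb : b ∈ A)
    {x y : H ⊗[k] H} (hxy : (rightBal A).mkQ x = (rightBal A).mkQ y) :
    (rightBal A).mkQ (x * (a ⊗ₜ b)) = (rightBal A).mkQ (y * (a ⊗ₜ b)) := by
  refine rightBal_congr ((rightBal A).mkQ ∘ₗ LinearMap.mulRight k (a ⊗ₜ b))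
    (fun c hc g h => ?_) hxy
  simp only [LinearMap.comp_apply, LinearMap.mulRight_apply,
    Algebra.TensorProduct.tmul_mul_tmul]
  rw [mul_assoc g, mul_assoc h, ← P.comm a ha c hc, ← P.comm b hb c hc, ← mul_assoc, ← mul_assoc,
    rightBal_bal hc]

theorem isLeftBialgebroid (P : IsDiagonal A δ S M) {ε : H →ₗ[k] A}
    (hε : ∀ m ∈ M, (ε m : H) = m * S m) : IsLeftBialgebroid (leftDiag A δ ε) where
  s_one := rfl
  s_mul _ _ := rfl
  t_one := rfl
  t_mul a b := P.comm a a.2 b b.2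
  s_t_comm a b := P.comm a a.2 b b.2
  comul_bimod a b h x hx := by
    have h1 : (leftBal A).mkQ x = (leftBal A).mkQ (δ h) := hx
    change (leftBal A).mkQ (((a : H) ⊗ₜ (b : H)) * x) = (leftBal A).mkQ (δ (a * b * h))
    rw [P.leftBal_mul_tmul a.2 b.2 h1, mul_assoc,
      P.isBaseLinear_leftBal.mul_left_fst a a.2]
    have e : ((a : H) ⊗ₜ[k] (b : H)) = ((a : H) ⊗ₜ (1 : H)) * ((1 : H) ⊗ₜ (b : H)) := by simp
    rw [e, mul_assoc]
    exact (P.leftBal_mul_tmul a.2 (one_mem A)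
      (P.isBaseLinear_leftBal.mul_left_snd b b.2 h)).symm
  counit_bimod a b h := by
    refine Subtype.ext ?_
    change (ε (a * b * h) : H) = a * ε h * b
    rw [mul_assoc, P.counitL_mul hε a.2, P.counitL_mul hε b.2, P.comm b b.2 _ (ε h).2,
      mul_assoc]
  coassoc := P.mixedCoassoc_of
    (fun _ _ h => tripleOfLeft_leftBal P.isBaseLinear_leftBal h)
    (fun _ _ h => tripleOfRight_leftBal P.isBaseLinear_leftBal h)
  counit_left h x hx := by
    refine (leftBal_congr (y := δ h)
      (LinearMap.mul' k H ∘ₗ (A.val.toLinearMap ∘ₗ ε).rTensor H) (fun a ha g h => ?_) hx).trans ?_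
    · change (ε (a * g) : H) * h = ε g * (a * h)
      rw [P.counitL_mul hε ha, P.comm a ha _ (ε g).2, mul_assoc]
    · refine P.linearMap_ext (f := LinearMap.mul' k H ∘ₗ
        (A.val.toLinearMap ∘ₗ ε).rTensor H ∘ₗ δ) (g := LinearMap.id) (fun m hm => ?_) h
      simp only [LinearMap.comp_apply]
      rw [P.comul_mem m hm]
      change (ε m : H) * m = m
      rw [hε m hm, P.mul_S_mul m hm]
  counit_right h x hx := by
    refine (leftBal_congr (y := δ h)
      (LinearMap.mul' k H ∘ₗ (A.val.toLinearMap ∘ₗ ε).rTensor H ∘ₗ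
        (TensorProduct.comm k H H).toLinearMap) (fun a ha g h => ?_) hx).trans ?_
    · change (ε h : H) * (a * g) = ε (a * h) * g
      rw [P.counitL_mul hε ha, P.comm a ha _ (ε h).2, mul_assoc]
    · refine P.linearMap_ext (f := LinearMap.mul' k H ∘ₗ
        (A.val.toLinearMap ∘ₗ ε).rTensor H ∘ₗ (TensorProduct.comm k H H).toLinearMap ∘ₗ δ)
        (g := LinearMap.id) (fun m hm => ?_) h
      simp only [LinearMap.comp_apply]
      rw [P.comul_mem m hm]
      change (ε m : H) * m = m
      rw [hε m hm, P.mul_S_mul m hm]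
  takeuchi h x a hx := by
    change (leftBal A).mkQ (x * ((a : H) ⊗ₜ 1)) = (leftBal A).mkQ (x * (1 ⊗ₜ (a : H)))
    rw [leftBal_mul_right (y := δ h) hx, leftBal_mul_right (y := δ h) hx,
      ← P.isBaseLinear_leftBal.mul_right_fst a a.2, P.isBaseLinear_leftBal.mul_right_snd a a.2]
  comul_one := P.comul_one_of (R := leftBal A) fun e _ hA hi => by
    conv_lhs => rw [← hi]
    simpa [hi] using (leftBal_bal hA e 1).symm
  comul_mul g h x y hx hy := by
    change (leftBal A).mkQ (x * y) = (leftBal A).mkQ (δ (g * h))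
    rw [leftBal_mul_right (y := δ g) hx, P.comul_mul]
    -- Left multiplication by `δ g` descends to the balanced product by the Takeuchi property `δ g *
    -- (a ⊗ 1) ≡ δ g * (1 ⊗ a)`.
    refine leftBal_congr ((leftBal A).mkQ ∘ₗ LinearMap.mulLeft k (δ g)) (fun a ha u v => ?_) hy
    have e := leftBal_mul_right ((P.isBaseLinear_leftBal.mul_right_fst a ha g).symm.trans
      (P.isBaseLinear_leftBal.mul_right_snd a ha g)) (u ⊗ₜ v)
    simpa only [LinearMap.comp_apply, LinearMap.mulLeft_apply, mul_assoc,
      Algebra.TensorProduct.tmul_mul_tmul, one_mul] using e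
  counit_one := Subtype.ext (P.counitL_base hε (one_mem A))
  counit_mul_s := P.counitL_mul_counit hε
  counit_mul_t := P.counitL_mul_counit hε

theorem isRightBialgebroid (P : IsDiagonal A δ S M) {ε : H →ₗ[k] A}
    (hε : ∀ m ∈ M, (ε m : H) = S m * m) : IsRightBialgebroid (rightDiag A δ ε) where
  s_one := rfl
  s_mul _ _ := rfl
  t_one := rfl
  t_mul a b := P.comm a a.2 b b.2
  s_t_comm a b := P.comm a a.2 b b.2
  comul_bimod a b h x hx := by
    have h1 : (rightBal A).mkQ x = (rightBal A).mkQ (δ h) := hx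
    change (rightBal A).mkQ (x * ((a : H) ⊗ₜ (b : H))) = (rightBal A).mkQ (δ (h * b * a))
    rw [P.rightBal_mul_tmul a.2 b.2 h1, P.isBaseLinear_rightBal.mul_right_fst a a.2]
    have e : ((a : H) ⊗ₜ[k] (b : H)) = ((1 : H) ⊗ₜ (b : H)) * ((a : H) ⊗ₜ (1 : H)) := by simp
    rw [e, ← mul_assoc]
    exact (P.rightBal_mul_tmul a.2 (one_mem A)
      (P.isBaseLinear_rightBal.mul_right_snd b b.2 h)).symm
  counit_bimod a b h := by
    refine Subtype.ext ?_
    change (ε (h * b * a) : H) = a * ε h * b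
    rw [P.counitR_mul hε a.2, P.counitR_mul hε b.2, ← P.comm a a.2 _ (A.mul_mem (ε h).2 b.2),
      mul_assoc]
  coassoc := P.mixedCoassoc_of
    (fun _ _ h => tripleOfLeft_rightBal P.isBaseLinear_rightBal h)
    (fun _ _ h => tripleOfRight_rightBal P.isBaseLinear_rightBal h)
  counit_right h x hx := by
    refine (rightBal_congr (y := δ h)
      (LinearMap.mul' k H ∘ₗ (A.val.toLinearMap ∘ₗ ε).lTensor H) (fun a ha g h => ?_) hx).trans ?_
    · change g * a * (ε h : H) = g * ε (h * a)
      rw [P.counitR_mul hε ha, ← P.comm a ha _ (ε h).2, mul_assoc]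
    · refine P.linearMap_ext (f := LinearMap.mul' k H ∘ₗ
        (A.val.toLinearMap ∘ₗ ε).lTensor H ∘ₗ δ) (g := LinearMap.id) (fun m hm => ?_) h
      simp only [LinearMap.comp_apply]
      rw [P.comul_mem m hm]
      change m * (ε m : H) = m
      rw [hε m hm, ← mul_assoc, P.mul_S_mul m hm]
  counit_left h x hx := by
    refine (rightBal_congr (y := δ h)
      (LinearMap.mul' k H ∘ₗ (A.val.toLinearMap ∘ₗ ε).lTensor H ∘ₗ
        (TensorProduct.comm k H H).toLinearMap) (fun a ha g h => ?_) hx).trans ?_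
    · change h * (ε (g * a) : H) = h * a * ε g
      rw [P.counitR_mul hε ha, ← P.comm a ha _ (ε g).2, mul_assoc]
    · refine P.linearMap_ext (f := LinearMap.mul' k H ∘ₗ
        (A.val.toLinearMap ∘ₗ ε).lTensor H ∘ₗ (TensorProduct.comm k H H).toLinearMap ∘ₗ δ)
        (g := LinearMap.id) (fun m hm => ?_) h
      simp only [LinearMap.comp_apply]
      rw [P.comul_mem m hm]
      change m * (ε m : H) = m
      rw [hε m hm, ← mul_assoc, P.mul_S_mul m hm]
  takeuchi h x a hx := by
    change (rightBal A).mkQ (((a : H) ⊗ₜ 1) * x) = (rightBal A).mkQ ((1 ⊗ₜ (a : H)) * x)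
    rw [rightBal_mul_left (y := δ h) hx, rightBal_mul_left (y := δ h) hx,
      ← P.isBaseLinear_rightBal.mul_left_fst a a.2, P.isBaseLinear_rightBal.mul_left_snd a a.2]
  comul_one := P.comul_one_of (R := rightBal A) fun e _ hA hi => by
    simpa [hi] using (rightBal_bal hA e 1).symm
  comul_mul g h x y hx hy := by
    change (rightBal A).mkQ (x * y) = (rightBal A).mkQ (δ (g * h))
    rw [rightBal_mul_left (y := δ h) hy, P.comul_mul]
    refine rightBal_congr ((rightBal A).mkQ ∘ₗ LinearMap.mulRight k (δ h))
      (fun a ha u v => ?_) hx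
    have e := rightBal_mul_left ((P.isBaseLinear_rightBal.mul_left_fst a ha h).symm.trans
      (P.isBaseLinear_rightBal.mul_left_snd a ha h)) (u ⊗ₜ v)
    simpa only [LinearMap.comp_apply, LinearMap.mulRight_apply, ← mul_assoc,
      Algebra.TensorProduct.tmul_mul_tmul, mul_one] using e
  counit_one := Subtype.ext (P.counitR_base hε (one_mem A))
  counit_mul_s := P.counitR_mul_counit hε
  counit_mul_t := P.counitR_mul_counit hε

/-- Hopf algebroid data whose base algebras coincide, commute, and embed by the source and target
maps, over a diagonal algebra. -/
theorem isHopfAlgebroid {A B : Subalgebra k H} (hAB : A = B) (D : HopfAlgebroidData k A B H)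
    (P : IsDiagonal A δ D.S M)
    (hls : D.left.s = A.val.toLinearMap) (hlt : D.left.t = A.val.toLinearMap)
    (hlΔ : ∀ h, D.left.Rep (δ h) h)
    (hrs : D.right.s = B.val.toLinearMap) (hrt : D.right.t = B.val.toLinearMap)
    (hrΔ : ∀ h, D.right.Rep (δ h) h)
    (hlε : ∀ m ∈ M, (D.left.ε m : H) = m * D.S m) (hrε : ∀ m ∈ M, (D.right.ε m : H) = D.S m * m)
    (hθ : ∀ a, (D.θ a : H) = a) : IsHopfAlgebroid D := by
  -- The type of `Δ` depends on the source and target maps, so these are replaced by the inclusion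
  -- first. For the same reason the hypotheses on `Δ` are stated through `Rep`.
  subst hAB
  obtain ⟨⟨ls, lt, lΔ, lε⟩, ⟨rs, rt, rΔ, rε⟩, θ, S⟩ := D
  simp only at *
  subst hls hlt hrs hrt
  obtain rfl : θ = LinearMap.id := LinearMap.ext fun a => Subtype.ext (hθ a)
  obtain rfl : lΔ = (leftBal A).mkQ ∘ₗ δ := LinearMap.ext fun h => (hlΔ h).symm
  obtain rfl : rΔ = (rightBal A).mkQ ∘ₗ δ := LinearMap.ext fun h => (hrΔ h).symm
  have hlb : ∀ a : A, (lε a : H) = a := fun a => P.counitL_base hlε a.2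
  have hrb : ∀ a : A, (rε a : H) = a := fun a => P.counitR_base hrε a.2
  exact
  { isLeft := P.isLeftBialgebroid hlε
    isRight := P.isRightBialgebroid hrε
    θ_bijective := Function.bijective_id
    θ_one := rfl
    θ_mul := fun a b => Subtype.ext (P.comm a a.2 b b.2)
    S_one := P.S_one
    S_mul := P.S_mul
    sl_εl_tr := LinearMap.ext hlb
    tl_εl_sr := LinearMap.ext hlb
    sr_εr_tl := LinearMap.ext hrb
    tr_εr_sl := LinearMap.ext hrb
    -- The first two factors are balanced on the left and the last two on the right: `Δ_l ⊗ id` must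
    -- respect right balancing, and `id ⊗ Δ_r` left balancing.
    coassoc_lr := P.mixedCoassoc_of
      (fun _ _ h => tripleOfLeft_rightBal P.isBaseLinear_leftBal h)
      (fun _ _ h => tripleOfRight_leftBal P.isBaseLinear_rightBal h)
    coassoc_rl := P.mixedCoassoc_of
      (fun _ _ h => tripleOfLeft_leftBal P.isBaseLinear_rightBal h)
      (fun _ _ h => tripleOfRight_rightBal P.isBaseLinear_leftBal h)
    S_bimod := fun a b h => by
      change S (a * h * b) = b * S h * a
      rw [P.S_mul, P.S_mul, P.S_base a a.2, P.S_base b b.2, mul_assoc]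
    antipode_left := fun h x hx => by
      refine (leftBal_congr (y := δ h) (LinearMap.mul' k H ∘ₗ S.rTensor H)
        (fun a ha g h => ?_) hx).trans ?_
      · change S (a * g) * h = S g * (a * h)
        rw [P.S_mul, P.S_base a ha, mul_assoc]
      · refine P.linearMap_ext (f := LinearMap.mul' k H ∘ₗ S.rTensor H ∘ₗ δ)
          (g := A.val.toLinearMap ∘ₗ rε) (fun m hm => ?_) h
        simp only [LinearMap.comp_apply]
        rw [P.comul_mem m hm]
        exact (hrε m hm).symm
    antipode_right := fun h x hx => by
      refine (rightBal_congr (y := δ h) (LinearMap.mul' k H ∘ₗ S.lTensor H)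
        (fun a ha g h => ?_) hx).trans ?_
      · change g * a * S h = g * S (h * a)
        rw [P.S_mul, P.S_base a ha, mul_assoc]
      · refine P.linearMap_ext (f := LinearMap.mul' k H ∘ₗ S.lTensor H ∘ₗ δ)
          (g := A.val.toLinearMap ∘ₗ lε) (fun m hm => ?_) h
        simp only [LinearMap.comp_apply]
        rw [P.comul_mem m hm]
        exact (hlε m hm).symm }

end IsDiagonal

end Diagonal

/-! ### The partial group algebra as a diagonal algebra, with the monomials as group-likes. -/

namespace PartialGroupAlgebra

variable {k : Type w} [CommRing k] {G : Type u} [Group G]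

theorem adjoin_range_of : Algebra.adjoin k (Set.range (of k (G := G))) = ⊤ := by
  have h1 : Set.range (of k (G := G)) = mk k '' Set.range (FreeAlgebra.ι k) := by
    rw [← Set.range_comp]
    rfl
  rw [h1, ← AlgHom.map_adjoin, FreeAlgebra.adjoin_range_ι, Algebra.map_top,
    AlgHom.range_eq_top]
  exact RingQuot.mkAlgHom_surjective k _

variable (k G) in
/-- The set of monomials in the generators `[g]`. -/
def monomials : Submonoid (PartialGroupAlgebra k G) := Submonoid.closure (Set.range (of k))

theorem of_mem_monomials (g : G) : of k g ∈ monomials k G := Submonoid.subset_closure ⟨g, rfl⟩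

theorem span_monomials : Submodule.span k (monomials k G : Set (PartialGroupAlgebra k G)) = ⊤ := by
  rw [monomials, ← Algebra.adjoin_eq_span, adjoin_range_of, Algebra.top_toSubmodule]

theorem antipode_of (g : G) : antipode (of k g) = of k g⁻¹ := by
  change MulOpposite.unop (antipodeHom (of k g)) = _
  rw [antipodeHom_of]
  rfl

theorem antipode_one : antipode (1 : PartialGroupAlgebra k G) = 1 := by
  change MulOpposite.unop (antipodeHom 1) = _
  simp

theorem antipode_mul (x y : PartialGroupAlgebra k G) :
    antipode (x * y) = antipode y * antipode x := by
  change MulOpposite.unop (antipodeHom (x * y)) = _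
  rw [map_mul]
  rfl

theorem antipode_eps (g : G) : antipode (eps k g) = eps k g := by
  rw [eps, antipode_mul, antipode_of, antipode_of, inv_inv]

theorem Apar_comm {a b : PartialGroupAlgebra k G} (ha : a ∈ Apar k G) (hb : b ∈ Apar k G) :
    a * b = b * a := by
  induction hb using Algebra.adjoin_induction with
  | mem x hx =>
    obtain ⟨h, rfl⟩ := hx
    exact (Apar_comm_eps ha h).symm
  | algebraMap r => exact (Algebra.commutes r _).symm
  | add x y _ _ hx hy => rw [mul_add, add_mul, hx, hy]
  | mul x y _ _ hx hy => rw [← mul_assoc, hx, mul_assoc, hy, mul_assoc]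

theorem eps_mul_eps (g : G) : eps k g * eps k g = eps k g := by
  conv_lhs => rw [eps, ← mul_assoc, of_inv_of]
  rfl

theorem antipode_mem_monomials {m : PartialGroupAlgebra k G} (hm : m ∈ monomials k G) :
    antipode m ∈ monomials k G := by
  induction hm using Submonoid.closure_induction with
  | mem x hx =>
    obtain ⟨g, rfl⟩ := hx
    rw [antipode_of]
    exact of_mem_monomials _
  | one =>
    rw [antipode_one]
    exact one_mem _
  | mul x y _ _ hx hy =>
    rw [antipode_mul]
    exact mul_mem hy hx

theorem antipode_antipode {m : PartialGroupAlgebra k G} (hm : m ∈ monomials k G) :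
    antipode (antipode m) = m := by
  induction hm using Submonoid.closure_induction with
  | mem x hx =>
    obtain ⟨g, rfl⟩ := hx
    rw [antipode_of, antipode_of, inv_inv]
  | one => rw [antipode_one, antipode_one]
  | mul x y _ _ hx hy => rw [antipode_mul, antipode_mul, hx, hy]

theorem monomial_conj_mem {m : PartialGroupAlgebra k G} (hm : m ∈ monomials k G) :
    ∀ a ∈ Apar k G, m * a * antipode m ∈ Apar k G := by
  induction hm using Submonoid.closure_induction with
  | mem x hx =>
    obtain ⟨g, rfl⟩ := hx
    intro a ha
    rw [antipode_of]
    exact conj_mem ha g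
  | one => simp [antipode_one]
  | mul x y _ _ hx hy =>
    intro a ha
    have h := hx _ (hy a ha)
    rw [antipode_mul]
    simpa only [mul_assoc] using h

theorem mul_antipode_mem {m : PartialGroupAlgebra k G} (hm : m ∈ monomials k G) :
    m * antipode m ∈ Apar k G := by
  simpa using monomial_conj_mem hm 1 (one_mem _)

theorem antipode_mul_mem {m : PartialGroupAlgebra k G} (hm : m ∈ monomials k G) :
    antipode m * m ∈ Apar k G := by
  simpa [antipode_antipode hm] using mul_antipode_mem (antipode_mem_monomials hm)

theorem mul_antipode_mul {m : PartialGroupAlgebra k G} (hm : m ∈ monomials k G) :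
    m * antipode m * m = m := by
  induction hm using Submonoid.closure_induction with
  | mem x hx =>
    obtain ⟨g, rfl⟩ := hx
    rw [antipode_of, of_inv_of]
  | one => simp [antipode_one]
  | mul x y hx' hy' hx hy =>
    -- As in an inverse semigroup, a product of partial isometries is again one because the final
    -- projection of `y` commutes with the initial projection of `x`.
    have h := Apar_comm (mul_antipode_mem hy') (antipode_mul_mem hx')
    calc x * y * antipode (x * y) * (x * y)
        = x * ((y * antipode y) * (antipode x * x)) * y := by
          simp only [antipode_mul, mul_assoc]
      _ = (x * antipode x * x) * (y * antipode y * y) := by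
          rw [h]
          simp only [mul_assoc]
      _ = x * y := by rw [hx, hy]

/-- A monomial acts on `A_par` by `a ↦ m * a * antipode m`, and the left counit is this action
evaluated at `1`. -/
theorem counitL_eq {m : PartialGroupAlgebra k G} (hm : m ∈ monomials k G) :
    (counitL m : PartialGroupAlgebra k G) = m * antipode m := by
  have key : ∀ a : Apar k G, (act m a : PartialGroupAlgebra k G) = m * a * antipode m := by
    induction hm using Submonoid.closure_induction with
    | mem x hx =>
      obtain ⟨g, rfl⟩ := hx
      intro a
      rw [antipode_of, act_of]
      rfl
    | one => simp [antipode_one]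
    | mul x y _ _ hx hy =>
      intro a
      rw [map_mul, Module.End.mul_apply, hx, hy, antipode_mul]
      simp only [mul_assoc]
  exact (key 1).trans (by simp)

theorem counitR_eq {m : PartialGroupAlgebra k G} (hm : m ∈ monomials k G) :
    (counitR m : PartialGroupAlgebra k G) = antipode m * m := by
  rw [counitR, LinearMap.comp_apply, counitL_eq (antipode_mem_monomials hm),
    antipode_antipode hm]

variable (k G) in
theorem isDiagonal : IsDiagonal (Apar k G) diag.toLinearMap antipode
    (monomials k G : Set (PartialGroupAlgebra k G)) where
  span_eq := span_monomials
  mul_mem _ hm _ hn := mul_mem hm hn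
  comul_mul := map_mul diag
  comul_mem m hm := by
    change diag m = _
    induction hm using Submonoid.closure_induction with
    | mem x hx =>
      obtain ⟨g, rfl⟩ := hx
      exact diag_of g
    | one => rw [map_one, Algebra.TensorProduct.one_def]
    | mul x y _ _ hx hy => rw [map_mul, hx, hy, Algebra.TensorProduct.tmul_mul_tmul]
  comm _ ha _ hb := Apar_comm ha hb
  base_le a ha := by
    have h1 : a ∈ Subalgebra.toSubmodule (Apar k G) := ha
    -- `A_par` is spanned by the products of the `ε_g`. These are monomials, and they are idempotent
    -- because the factors commute.
    rw [Apar, Algebra.adjoin_eq_span] at h1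
    refine Submodule.span_mono (fun e he => ?_) h1
    induction he using Submonoid.closure_induction with
    | mem x hx =>
      obtain ⟨g, rfl⟩ := hx
      exact ⟨mul_mem (of_mem_monomials _) (of_mem_monomials _), eps_mem g, eps_mul_eps g⟩
    | one => exact ⟨one_mem _, one_mem _, one_mul _⟩
    | mul x y _ _ hx hy =>
      refine ⟨mul_mem hx.1 hy.1, mul_mem hx.2.1 hy.2.1, ?_⟩
      rw [mul_assoc, ← mul_assoc y, Apar_comm hy.2.1 hx.2.1, mul_assoc x y y, hy.2.2,
        ← mul_assoc, hx.2.2]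
  S_one := antipode_one
  S_mul := antipode_mul
  S_base a ha := by
    induction ha using Algebra.adjoin_induction with
    | mem x hx =>
      obtain ⟨h, rfl⟩ := hx
      exact antipode_eps h
    | algebraMap r => rw [Algebra.algebraMap_eq_smul_one, map_smul, antipode_one]
    | add x y _ _ hx hy => rw [map_add, hx, hy]
    | mul x y hx' hy' hx hy => rw [antipode_mul, hx, hy, Apar_comm hy' hx']
  S_mem _ hm := antipode_mem_monomials hm
  S_S _ hm := antipode_antipode hm
  mul_S_mul _ hm := mul_antipode_mul hm
  conj_mem _ hm := monomial_conj_mem hm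

variable (k G) in
theorem isHopfAlgebroid : IsHopfAlgebroid (hopfAlgebroidData k G) :=
  IsDiagonal.isHopfAlgebroid rfl _ (isDiagonal k G) rfl rfl (fun _ => rfl) rfl rfl (fun _ => rfl)
    (fun _ hm => counitL_eq hm) (fun _ hm => counitR_eq hm) (fun _ => rfl)

end PartialGroupAlgebra

open CategoryTheory

/-! ### The groupoid algebra as a diagonal algebra, with base spanned by the identity arrows. -/

namespace GroupoidAlgebra

variable {k : Type w} [CommRing k] {C : Type u} [Groupoid.{v} C]

variable (k) in
/-- The identity arrow at `x` as an element of the groupoid algebra. -/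
def idArr (x : C) : GroupoidAlgebra k C := arr k ⟨x, x, 𝟙 x⟩

theorem span_range_arr : Submodule.span k (Set.range (arr k (C := C))) = ⊤ := by
  refine eq_top_iff.2 fun a _ => ?_
  induction a using induction_on with
  | zero => exact zero_mem _
  | add a b ha hb => exact add_mem (ha trivial) (hb trivial)
  | smul_arr r γ => exact Submodule.smul_mem _ _ (Submodule.subset_span ⟨γ, rfl⟩)

theorem idArr_mul_idArr (x : C) : idArr k x * idArr k x = idArr k x := by
  simp only [idArr, arr_mul_of_eq, Category.comp_id]

theorem idArr_mul_arr (γ : Arr C) : idArr k γ.tgt * arr k γ = arr k γ := by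
  obtain ⟨x, y, f⟩ := γ
  rw [idArr, arr_mul_of_eq, Category.comp_id]

theorem arr_mul_idArr (γ : Arr C) : arr k γ * idArr k γ.src = arr k γ := by
  obtain ⟨x, y, f⟩ := γ
  rw [idArr, arr_mul_of_eq, Category.id_comp]

variable [Fintype C]

theorem idArr_mul_idArr_of_ne {x y : C} (h : x ≠ y) : idArr k x * idArr k y = 0 :=
  arr_mul_of_ne (γ := ⟨x, x, 𝟙 x⟩) (δ := ⟨y, y, 𝟙 y⟩) h.symm

theorem arr_mul_arr_eq_zero_or (γ δ : Arr C) :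
    arr k γ * arr k δ = 0 ∨ ∃ η, arr k γ * arr k δ = arr k η := by
  obtain ⟨x, y, f⟩ := δ
  obtain ⟨y', z, g⟩ := γ
  by_cases h : y = y'
  · subst h
    exact Or.inr ⟨_, arr_mul_of_eq f g⟩
  · exact Or.inl (arr_mul_of_ne (γ := ⟨y', z, g⟩) (δ := ⟨x, y, f⟩) h)

theorem epsS'_idArr (y : C) : epsS' k (GroupoidAlgebra k C) (idArr k y) = idArr k y := by
  simp only [epsS', LinearMap.comp_apply, TensorProduct.mk_apply,
    LinearMap.mulLeft_apply, comul_one', Finset.sum_mul, Algebra.TensorProduct.tmul_mul_tmul,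
    map_sum, LinearMap.lTensor_tmul, mul_one, LinearEquiv.coe_coe, TensorProduct.rid_tmul]
  rw [Finset.sum_eq_single y]
  · rw [idArr, arr_mul_of_eq, counit_arr, one_smul]
  · intro z _ hz
    have h := idArr_mul_idArr_of_ne (k := k) hz
    unfold idArr at h ⊢
    rw [h, map_zero, zero_smul]
  · simp

theorem epsT'_idArr (y : C) : epsT' k (GroupoidAlgebra k C) (idArr k y) = idArr k y := by
  simp only [epsT', LinearMap.comp_apply, LinearMap.flip_apply, TensorProduct.mk_apply,
    LinearMap.mulRight_apply, comul_one', Finset.mul_sum, Algebra.TensorProduct.tmul_mul_tmul,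
    map_sum, LinearMap.rTensor_tmul, one_mul, LinearEquiv.coe_coe, TensorProduct.lid_tmul]
  rw [Finset.sum_eq_single y]
  · rw [idArr, arr_mul_of_eq, counit_arr, one_smul]
  · intro z _ hz
    have h := idArr_mul_idArr_of_ne (k := k) hz.symm
    unfold idArr at h ⊢
    rw [h, map_zero, zero_smul]
  · simp

/-- `ε_t` sends each arrow to the identity at its target, and every identity arrow arises in this
way. -/
theorem toSubmodule_targetAlg :
    Subalgebra.toSubmodule (isWeakHopfAlgebra (k := k) (C := C)).targetAlg =
      Submodule.span k (Set.range (idArr k)) := by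
  have h : Subalgebra.toSubmodule (isWeakHopfAlgebra (k := k) (C := C)).targetAlg =
      LinearMap.range (epsT k (GroupoidAlgebra k C)) := rfl
  rw [h, LinearMap.range_eq_map, ← span_range_arr, Submodule.map_span, ← Set.range_comp]
  congr 1
  ext a
  constructor
  · rintro ⟨γ, rfl⟩
    exact ⟨γ.tgt, (epsT_arr γ).symm⟩
  · rintro ⟨x, rfl⟩
    exact ⟨⟨x, x, 𝟙 x⟩, epsT_arr _⟩

theorem toSubmodule_sourceAlg :
    Subalgebra.toSubmodule (isWeakHopfAlgebra (k := k) (C := C)).sourceAlg =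
      Submodule.span k (Set.range (idArr k)) := by
  have h : Subalgebra.toSubmodule (isWeakHopfAlgebra (k := k) (C := C)).sourceAlg =
      LinearMap.range (epsS k (GroupoidAlgebra k C)) := rfl
  rw [h, LinearMap.range_eq_map, ← span_range_arr, Submodule.map_span, ← Set.range_comp]
  congr 1
  ext a
  constructor
  · rintro ⟨γ, rfl⟩
    exact ⟨γ.src, (epsS_arr γ).symm⟩
  · rintro ⟨x, rfl⟩
    exact ⟨⟨x, x, 𝟙 x⟩, epsS_arr _⟩

theorem targetAlg_eq_sourceAlg : (isWeakHopfAlgebra (k := k) (C := C)).targetAlg =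
    (isWeakHopfAlgebra (k := k) (C := C)).sourceAlg :=
  Subalgebra.toSubmodule_injective (toSubmodule_targetAlg.trans toSubmodule_sourceAlg.symm)

theorem mem_targetAlg {a : GroupoidAlgebra k C} :
    a ∈ (isWeakHopfAlgebra (k := k) (C := C)).targetAlg ↔
      a ∈ Submodule.span k (Set.range (idArr k)) := by
  rw [← toSubmodule_targetAlg]
  rfl

theorem idArr_mem_targetAlg (x : C) :
    idArr k x ∈ (isWeakHopfAlgebra (k := k) (C := C)).targetAlg :=
  mem_targetAlg.2 (Submodule.subset_span ⟨x, rfl⟩)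

theorem base_ext {N : Type*} [AddCommGroup N] [Module k N] {f g : GroupoidAlgebra k C →ₗ[k] N}
    (h : ∀ x, f (idArr k x) = g (idArr k x)) {a : GroupoidAlgebra k C}
    (ha : a ∈ (isWeakHopfAlgebra (k := k) (C := C)).targetAlg) : f a = g a :=
  LinearMap.eqOn_span (s := Set.range (idArr k)) (by rintro _ ⟨x, rfl⟩; exact h x)
    (mem_targetAlg.1 ha)

theorem antipode_arr (γ : Arr C) :
    antipode (arr k γ) = arr k ⟨γ.tgt, γ.src, Groupoid.inv γ.hom⟩ := by
  rw [antipode, extend_arr]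

theorem antipode_idArr (x : C) : antipode (idArr k x) = idArr k x := by
  rw [idArr, antipode_arr]
  simp

theorem arr_mul_antipode (γ : Arr C) : arr k γ * antipode (arr k γ) = idArr k γ.tgt := by
  obtain ⟨x, y, f⟩ := γ
  rw [antipode_arr, arr_mul_of_eq, Groupoid.inv_comp]
  rfl

theorem antipode_mul_arr (γ : Arr C) : antipode (arr k γ) * arr k γ = idArr k γ.src := by
  obtain ⟨x, y, f⟩ := γ
  rw [antipode_arr, arr_mul_of_eq, Groupoid.comp_inv]
  rfl

theorem arr_mul_idArr_of_ne {γ : Arr C} {x : C} (h : x ≠ γ.src) : arr k γ * idArr k x = 0 :=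
  arr_mul_of_ne (δ := ⟨x, x, 𝟙 x⟩) h

theorem antipode_arr_mul (γ δ : Arr C) :
    antipode (arr k γ * arr k δ) = antipode (arr k δ) * antipode (arr k γ) := by
  obtain ⟨x, y, f⟩ := δ
  obtain ⟨y', z, g⟩ := γ
  rw [antipode_arr, antipode_arr]
  by_cases h : y = y'
  · subst h
    rw [arr_mul_of_eq, antipode_arr, arr_mul_of_eq]
    simp
  · rw [arr_mul_of_ne (γ := ⟨y', z, g⟩) (δ := ⟨x, y, f⟩) h, map_zero,
      arr_mul_of_ne (γ := ⟨y, x, _⟩) (δ := ⟨z, y', _⟩) (Ne.symm h)]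

theorem antipode_mul (a b : GroupoidAlgebra k C) :
    antipode (a * b) = antipode b * antipode a := by
  have key : (LinearMap.mul k (GroupoidAlgebra k C)).compr₂ antipode =
      ((LinearMap.mul k (GroupoidAlgebra k C)).flip.compl₂ antipode) ∘ₗ antipode :=
    hom_ext fun γ => hom_ext fun δ => antipode_arr_mul γ δ
  exact LinearMap.congr_fun (LinearMap.congr_fun key a) b

/-- The identity arrows are orthogonal idempotents. -/
theorem targetAlg_comm {a b : GroupoidAlgebra k C}
    (ha : a ∈ (isWeakHopfAlgebra (k := k) (C := C)).targetAlg)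
    (hb : b ∈ (isWeakHopfAlgebra (k := k) (C := C)).targetAlg) : a * b = b * a := by
  refine base_ext (f := LinearMap.mulLeft k a) (g := LinearMap.mulRight k a) (fun y => ?_) hb
  refine base_ext (f := LinearMap.mulRight k (idArr k y)) (g := LinearMap.mulLeft k (idArr k y))
    (fun x => ?_) ha
  change idArr k x * idArr k y = idArr k y * idArr k x
  by_cases h : x = y
  · rw [h]
  · rw [idArr_mul_idArr_of_ne h, idArr_mul_idArr_of_ne (Ne.symm h)]

-- The element `0` is added to the arrows because the product of two non-composable arrows is `0`,
-- which must stay in `M`.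
variable (k C) in
theorem isDiagonal : IsDiagonal (isWeakHopfAlgebra (k := k) (C := C)).targetAlg
    Coalgebra.comul antipode (insert 0 (Set.range (arr k))) where
  span_eq := by rw [Submodule.span_insert_zero, span_range_arr]
  mul_mem := by
    rintro _ (rfl | ⟨γ, rfl⟩) _ (rfl | ⟨δ, rfl⟩)
    · simp
    · simp
    · simp
    · obtain h | ⟨η, h⟩ := arr_mul_arr_eq_zero_or (k := k) γ δ
      · exact Or.inl h
      · exact Or.inr ⟨η, h.symm⟩
  comul_mul := isWeakBialgebra.comul_mul
  comul_mem := by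
    rintro _ (rfl | ⟨γ, rfl⟩)
    · simp
    · exact comul_arr γ
  comm _ ha _ hb := targetAlg_comm ha hb
  base_le a ha := by
    refine Submodule.span_mono ?_ (mem_targetAlg.1 ha)
    rintro _ ⟨x, rfl⟩
    exact ⟨Or.inr ⟨_, rfl⟩, idArr_mem_targetAlg x, idArr_mul_idArr x⟩
  S_one := by
    rw [one_def, map_sum]
    exact Finset.sum_congr rfl fun x _ => antipode_idArr x
  S_mul := antipode_mul
  S_base a ha := base_ext (g := LinearMap.id) antipode_idArr ha
  S_mem := by
    rintro _ (rfl | ⟨γ, rfl⟩)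
    · simp
    · rw [antipode_arr]
      exact Or.inr ⟨_, rfl⟩
  S_S := by
    rintro _ (rfl | ⟨γ, rfl⟩)
    · simp
    · rw [antipode_arr, antipode_arr]
      simp
  mul_S_mul := by
    rintro _ (rfl | ⟨γ, rfl⟩)
    · simp
    · rw [arr_mul_antipode, idArr_mul_arr]
  conj_mem := by
    rintro _ (rfl | ⟨γ, rfl⟩) a ha
    · simp
    · have h : arr k γ * a * antipode (arr k γ) ∈
          Submodule.span k (Set.range (idArr k)) := by
        have ha' := mem_targetAlg.1 ha
        induction ha' using Submodule.span_induction with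
        | mem _ hx =>
          obtain ⟨x, rfl⟩ := hx
          by_cases h : x = γ.src
          · rw [h, arr_mul_idArr, arr_mul_antipode]
            exact Submodule.subset_span ⟨_, rfl⟩
          · rw [arr_mul_idArr_of_ne h, zero_mul]
            exact zero_mem _
        | zero => simp
        | add x y hx' hy' hx hy =>
          rw [mul_add, add_mul]
          exact add_mem (hx (mem_targetAlg.2 hx')) (hy (mem_targetAlg.2 hy'))
        | smul r x hx' hx =>
          rw [mul_smul_comm, smul_mul_assoc]
          exact Submodule.smul_mem _ _ (hx (mem_targetAlg.2 hx'))
      exact mem_targetAlg.2 h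

-- On the identity arrows `ε_s'`, `ε_t'` and `ε_s` all act as the identity, so the target maps and
-- the base anti-isomorphism are inclusions and the criterion for diagonal algebras applies.
variable (k C) in
theorem isHopfAlgebroid :
    IsHopfAlgebroid (isWeakHopfAlgebra (k := k) (C := C)).hopfAlgebroidData := by
  have hmem : ∀ a : (isWeakHopfAlgebra (k := k) (C := C)).sourceAlg,
      (a : GroupoidAlgebra k C) ∈ (isWeakHopfAlgebra (k := k) (C := C)).targetAlg :=
    fun a => targetAlg_eq_sourceAlg.symm.le a.2
  refine IsDiagonal.isHopfAlgebroid targetAlg_eq_sourceAlg _ (isDiagonal k C) rfl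
    (LinearMap.ext fun a => base_ext (g := LinearMap.id) epsS'_idArr a.2) (fun _ => rfl) rfl
    (LinearMap.ext fun a => base_ext (g := LinearMap.id) epsT'_idArr (hmem a)) (fun _ => rfl)
    ?_ ?_ fun a => base_ext (f := epsS k _) (g := LinearMap.id)
      (fun x => epsS_arr ⟨x, x, 𝟙 x⟩) a.2
  · rintro _ (rfl | ⟨γ, rfl⟩)
    · simp
    · exact (epsT_arr γ).trans (arr_mul_antipode γ).symm
  · rintro _ (rfl | ⟨γ, rfl⟩)
    · simp
    · exact (epsS_arr γ).trans (antipode_mul_arr γ).symm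

end GroupoidAlgebra

/-! ### Counit compatibility from the antipode laws. -/

section Morphisms

variable {k : Type*} [CommRing k] {H A B H' A' B' : Type*} [Ring H] [Algebra k H] [Ring A]
  [Algebra k A] [Ring B] [Algebra k B] [Ring H'] [Algebra k H'] [Ring A'] [Algebra k A']
  [Ring B'] [Algebra k B']

/-- An isomorphism that is compatible with sources, targets, comultiplications and antipodes is
compatible with the counits. -/
theorem isHopfAlgebroidIso_of {D : HopfAlgebroidData k A B H} {D' : HopfAlgebroidData k A' B' H'}
    (hD : IsHopfAlgebroid D) (hD' : IsHopfAlgebroid D')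
    (hls : Function.Injective D'.left.s) (hrs : Function.Injective D'.right.s)
    {Φ : H ≃ₐ[k] H'} {φ : A ≃ₐ[k] A'} {ψ : B ≃ₐ[k] B'}
    (sourceL : ∀ a, D'.left.s (φ a) = Φ (D.left.s a))
    (targetL : ∀ a, D'.left.t (φ a) = Φ (D.left.t a))
    (comulL : ∀ h x, D.left.Rep x h →
      D'.left.Rep (TensorProduct.map Φ.toLinearMap Φ.toLinearMap x) (Φ h))
    (sourceR : ∀ a, D'.right.s (ψ a) = Φ (D.right.s a))
    (targetR : ∀ a, D'.right.t (ψ a) = Φ (D.right.t a))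
    (comulR : ∀ h x, D.right.Rep x h →
      D'.right.Rep (TensorProduct.map Φ.toLinearMap Φ.toLinearMap x) (Φ h))
    (base : ∀ a, ψ (D.θ a) = D'.θ (φ a)) (antipode : ∀ h, Φ (D.S h) = D'.S (Φ h)) :
    IsHopfAlgebroidIso D D' Φ φ ψ where
  left :=
    { source := LinearMap.ext sourceL
      target := LinearMap.ext targetL
      counit := by
        refine LinearMap.ext fun h => hls ?_
        -- The law `h⁽¹⁾ S(h⁽²⁾) = s_l(ε_l(h))` expresses the left counit by the right coproduct and
        -- the antipode, both of which `Φ` respects; injectivity of the source map then gives the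
        -- counit itself.
        obtain ⟨x, hx⟩ := Submodule.mkQ_surjective _ (D.right.Δ h)
        refine (hD'.antipode_right _ _ (comulR h x hx)).symm.trans
          (Eq.trans ?_ (sourceL (D.left.ε h)).symm)
        rw [← hD.antipode_right h x hx]
        clear hx
        induction x with
        | zero => simp
        | add u v hu hv => simp only [map_add, hu, hv]
        | tmul u v => simp [antipode]
      comul := comulL }
  right :=
    { source := LinearMap.ext sourceR
      target := LinearMap.ext targetR
      counit := by
        refine LinearMap.ext fun h => hrs ?_
        obtain ⟨x, hx⟩ := Submodule.mkQ_surjective _ (D.left.Δ h)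
        refine (hD'.antipode_left _ _ (comulL h x hx)).symm.trans
          (Eq.trans ?_ (sourceR (D.right.ε h)).symm)
        rw [← hD.antipode_left h x hx]
        clear hx
        induction x with
        | zero => simp
        | add u v hu hv => simp only [map_add, hu, hv]
        | tmul u v => simp [antipode]
      comul := comulR }
  base := LinearMap.ext base
  antipode := LinearMap.ext antipode

end Morphisms

/-! ### Atoms of the Boolean algebra generated by finitely many idempotents. -/

section Atoms

variable {R : Type*} [CommRing R] {ι : Type*} [Fintype ι] [DecidableEq ι]

/-- The atom of the Boolean algebra generated by the idempotents `e i` that lies below `e i`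
exactly for `i ∈ X`. -/
def atom (e : ι → R) (X : Finset ι) : R := ∏ i, if i ∈ X then e i else 1 - e i

/-- The sum is the expansion of the product of the factors `e i + (1 - e i) = 1`. -/
theorem sum_atom (e : ι → R) : ∑ X : Finset ι, atom e X = 1 := by
  have h := Finset.prod_add e (fun i => 1 - e i) Finset.univ
  simp only [add_sub_cancel, Finset.prod_const_one, Finset.powerset_univ] at h
  rw [h]
  refine Finset.sum_congr rfl fun X _ => ?_
  rw [atom, Finset.prod_ite]
  congr 2 <;> ext <;> simp

theorem mul_atom {e : ι → R} (he : ∀ i, e i * e i = e i) (i : ι) (X : Finset ι) :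
    e i * atom e X = if i ∈ X then atom e X else 0 := by
  rw [atom, ← Finset.mul_prod_erase _ _ (Finset.mem_univ i), ← mul_assoc]
  split_ifs
  · rw [he]
  · rw [mul_sub, he, mul_one, sub_self, zero_mul]

end Atoms

/-! ### The atoms of `A_par` and how the generators act on them. -/

namespace PartialGroupAlgebra

variable {k : Type w} [CommRing k] {G : Type u} [Group G]

variable (k G) in
/-- The commutative ring structure of `A_par`. -/
abbrev aparCommRing : CommRing (Apar k G) :=
  { (inferInstance : Ring (Apar k G)) with
    mul_comm := fun a b => Subtype.ext (Apar_comm a.2 b.2) }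

theorem eps_one : eps k (1 : G) = 1 := by simp [eps, of_one]

theorem of_mul_eps_inv (g : G) : of k g * eps k g⁻¹ = of k g := by
  rw [eps, inv_inv, ← mul_assoc, of_inv_of]

variable [Fintype G] [DecidableEq G]

variable (k) in
/-- The atom of `A_par` belonging to the subset `X` of `G`. -/
def aparAtom (X : Finset G) : Apar k G :=
  letI := aparCommRing k G
  atom (fun g => (⟨eps k g, eps_mem g⟩ : Apar k G)) X

theorem eps_mul_aparAtom (g : G) (X : Finset G) :
    eps k g * aparAtom k X = if g ∈ X then (aparAtom k X : PartialGroupAlgebra k G) else 0 := by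
  let := aparCommRing k G
  have h := mul_atom (e := fun g => (⟨eps k g, eps_mem g⟩ : Apar k G))
    (fun i => Subtype.ext (eps_mul_eps i)) g X
  have h' := congrArg Subtype.val h
  refine Eq.trans h' ?_
  split_ifs <;> rfl

/-- Because `ε_1 = 1`; this is why only subsets containing the neutral element occur as objects of
the groupoid. -/
theorem aparAtom_eq_zero {X : Finset G} (h : 1 ∉ X) :
    (aparAtom k X : PartialGroupAlgebra k G) = 0 := by
  have h1 := eps_mul_aparAtom (k := k) 1 X
  rwa [eps_one, one_mul, if_neg h] at h1

theorem sum_aparAtom : ∑ X : PE G, (aparAtom k X.set : PartialGroupAlgebra k G) = 1 := by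
  let := aparCommRing k G
  have h := sum_atom (fun g => (⟨eps k g, eps_mem g⟩ : Apar k G))
  have h' := congrArg (Apar k G).val h
  rw [map_sum, map_one] at h'
  rw [← h']
  refine Finset.sum_bij_ne_zero (fun X _ _ => X.set) (fun _ _ _ => Finset.mem_univ _)
    (fun _ _ _ _ _ _ e => PE.ext e) (fun X _ hX => ?_) (fun _ _ _ => rfl)
  have h1 : (1 : G) ∈ X := by
    by_contra h1
    exact hX (aparAtom_eq_zero h1)
  exact ⟨⟨X, h1⟩, Finset.mem_univ _, hX, rfl⟩

/-- The counterpart of the fact that `(g, X)` is then not an arrow: `[g] = [g] ε_{g⁻¹}`, and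
`ε_{g⁻¹}` kills the atom. -/
theorem of_mul_aparAtom {g : G} {X : Finset G} (h : g⁻¹ ∉ X) :
    of k g * (aparAtom k X : PartialGroupAlgebra k G) = 0 := by
  rw [← of_mul_eps_inv, mul_assoc, eps_mul_aparAtom, if_neg h, mul_zero]

/-- The atom absorbs `ε_{h⁻¹} = [h⁻¹][h]`, which makes the relation for `[g][h][h⁻¹]` applicable.
This mirrors the composition of arrows. -/
theorem of_mul_of_mul_aparAtom (g : G) {h : G} {X : Finset G} (hX : h⁻¹ ∈ X) :
    of k g * (of k h * (aparAtom k X : PartialGroupAlgebra k G)) =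
      of k (g * h) * aparAtom k X := by
  have e : (aparAtom k X : PartialGroupAlgebra k G) = eps k h⁻¹ * aparAtom k X := by
    rw [eps_mul_aparAtom, if_pos hX]
  rw [e, eps, inv_inv]
  simp only [← mul_assoc]
  rw [of_right]

end PartialGroupAlgebra

/-! ### The algebra isomorphism between the partial group algebra and the groupoid algebra. -/

section Isomorphism

variable {k : Type w} [CommRing k] {G : Type u} [Group G] [DecidableEq G]

theorem Arr.ext_of_val {γ δ : Arr (PE G)} (h1 : γ.src = δ.src)
    (h2 : PE.Hom.val γ.hom = PE.Hom.val δ.hom) : γ = δ := by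
  obtain ⟨X, ⟨Y, hY⟩, ⟨g, h3, h4⟩⟩ := γ
  obtain ⟨X', ⟨Y', hY'⟩, ⟨g', h3', h4'⟩⟩ := δ
  obtain rfl : X = X' := h1
  obtain rfl : g = g' := h2
  obtain rfl : g • X.set = Y := h4
  obtain rfl : g • X.set = Y' := h4'
  rfl

open Classical in
variable (k) in
/-- The arrow `(g, X)` if `g⁻¹ ∈ X`, and zero otherwise. -/
def pairArr (g : G) (X : PE G) : GroupoidAlgebra k (PE G) :=
  if h : g⁻¹ ∈ X.set then GroupoidAlgebra.arr k (pair g X h) else 0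

theorem pairArr_of_mem {g : G} {X : PE G} (h : g⁻¹ ∈ X.set) :
    pairArr k g X = GroupoidAlgebra.arr k (pair g X h) := dif_pos h

theorem pairArr_of_notMem {g : G} {X : PE G} (h : g⁻¹ ∉ X.set) : pairArr k g X = 0 := dif_neg h

theorem pairArr_arr (γ : Arr (PE G)) :
    pairArr k (PE.Hom.val γ.hom) γ.src = GroupoidAlgebra.arr k γ := by
  rw [pairArr_of_mem (PE.Hom.inv_mem γ.hom)]
  exact congrArg _ (Arr.ext_of_val rfl rfl)

theorem pairArr_one (X : PE G) : pairArr k 1 X = GroupoidAlgebra.idArr k X :=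
  pairArr_arr ⟨X, X, 𝟙 X⟩

theorem comul_pairArr (g : G) (X : PE G) :
    Coalgebra.comul (R := k) (pairArr k g X) = pairArr k g X ⊗ₜ pairArr k g X := by
  by_cases h : g⁻¹ ∈ X.set
  · rw [pairArr_of_mem h, GroupoidAlgebra.comul_arr]
  · simp [pairArr_of_notMem h]

theorem idArr_mul_pairArr {g : G} {X : PE G} (h : g⁻¹ ∈ X.set) :
    GroupoidAlgebra.idArr k (X.translate g h) * pairArr k g X = pairArr k g X := by
  rw [pairArr_of_mem h]
  exact GroupoidAlgebra.idArr_mul_arr (pair g X h)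

variable [Fintype G]

theorem idArr_mul_pairArr_of_ne {g : G} {X Y : PE G} (h : Y.set ≠ g • X.set) :
    GroupoidAlgebra.idArr k Y * pairArr k g X = 0 := by
  by_cases hg : g⁻¹ ∈ X.set
  · rw [pairArr_of_mem hg]
    refine GroupoidAlgebra.arr_mul_of_ne (γ := ⟨Y, Y, 𝟙 Y⟩) fun e => h ?_
    exact congrArg PE.set e.symm
  · rw [pairArr_of_notMem hg, mul_zero]

theorem pairArr_mul_idArr (g : G) (X : PE G) :
    pairArr k g X * GroupoidAlgebra.idArr k X = pairArr k g X := by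
  by_cases h : g⁻¹ ∈ X.set
  · rw [pairArr_of_mem h]
    exact GroupoidAlgebra.arr_mul_idArr (pair g X h)
  · rw [pairArr_of_notMem h, zero_mul]

theorem pairArr_mul_idArr_of_ne (g : G) {X Y : PE G} (h : Y ≠ X) :
    pairArr k g X * GroupoidAlgebra.idArr k Y = 0 := by
  by_cases hg : g⁻¹ ∈ X.set
  · rw [pairArr_of_mem hg]
    exact GroupoidAlgebra.arr_mul_idArr_of_ne (γ := pair g X hg) h
  · rw [pairArr_of_notMem hg, zero_mul]

/-- Since `g⁻¹ ∈ hX` if and only if `(gh)⁻¹ ∈ X`, both sides vanish together, so extension by zero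
leaves a product rule without a condition on `g`. -/
theorem pairArr_mul_pairArr (g : G) {h : G} {X : PE G} (hX : h⁻¹ ∈ X.set) :
    pairArr k g (X.translate h hX) * pairArr k h X = pairArr k (g * h) X := by
  have key : g⁻¹ ∈ (X.translate h hX).set ↔ (g * h)⁻¹ ∈ X.set := by
    rw [mul_inv_rev, ← smul_eq_mul]
    exact Finset.inv_smul_mem_iff.symm
  by_cases hg : g⁻¹ ∈ (X.translate h hX).set
  · rw [pairArr_of_mem hg, pairArr_of_mem hX, pairArr_of_mem (key.1 hg)]
    refine (GroupoidAlgebra.arr_mul_of_eq _ _).trans (congrArg _ (Arr.ext_of_val rfl rfl))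
  · rw [pairArr_of_notMem hg, pairArr_of_notMem fun h' => hg (key.2 h'), zero_mul]

theorem pairArr_mul_pairArr_of_ne (g h : G) {X Y : PE G} (hX : Y.set ≠ h • X.set) :
    pairArr k g Y * pairArr k h X = 0 := by
  rw [← pairArr_mul_idArr, mul_assoc, idArr_mul_pairArr_of_ne hX, mul_zero]

variable (k) in
/-- The partial representation `g ↦ ∑ (g, X)` of `G` in the groupoid algebra of `Γ(G)`. -/
def parRep (g : G) : GroupoidAlgebra k (PE G) := ∑ X : PE G, pairArr k g X

theorem parRep_eq_sum (g : G) : parRep k g =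
    ∑ X : {X : PE G // g⁻¹ ∈ X.set}, GroupoidAlgebra.arr k (pair g X.1 X.2) := by
  classical
  rw [parRep, ← Finset.sum_subset (Finset.subset_univ (Finset.univ.filter
      fun X : PE G => g⁻¹ ∈ X.set)),
    Finset.sum_subtype _ (p := fun X : PE G => g⁻¹ ∈ X.set) (by simp)]
  · exact Finset.sum_congr rfl fun X _ => pairArr_of_mem X.2
  · intro X _ hX
    exact pairArr_of_notMem (by simpa using hX)

/-- Only the summand with source `hX` is composable with `(h, X)`. -/
theorem parRep_mul_pairArr (g : G) {h : G} {X : PE G} (hX : h⁻¹ ∈ X.set) :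
    parRep k g * pairArr k h X = pairArr k (g * h) X := by
  rw [parRep, Finset.sum_mul, Finset.sum_eq_single (X.translate h hX), pairArr_mul_pairArr]
  · intro Y _ hY
    exact pairArr_mul_pairArr_of_ne g h fun e => hY (PE.ext e)
  · simp

theorem parRep_mul_idArr (g : G) (X : PE G) :
    parRep k g * GroupoidAlgebra.idArr k X = pairArr k g X := by
  rw [← pairArr_one, parRep_mul_pairArr g (by simpa using X.one_mem), mul_one]

theorem sum_idArr : ∑ X : PE G, GroupoidAlgebra.idArr k X = 1 := rfl

/-- Identities are tested one source object at a time, as `1` is the sum of the identity arrows. -/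
theorem eq_of_mul_idArr {a b : GroupoidAlgebra k (PE G)}
    (h : ∀ X, a * GroupoidAlgebra.idArr k X = b * GroupoidAlgebra.idArr k X) : a = b := by
  rw [← mul_one a, ← mul_one b, ← sum_idArr, Finset.mul_sum, Finset.mul_sum]
  exact Finset.sum_congr rfl fun X _ => h X

theorem parRep_one : parRep k (1 : G) = 1 := by
  rw [parRep, ← sum_idArr]
  exact Finset.sum_congr rfl fun X _ => pairArr_one X

theorem parRep_right (g h : G) :
    parRep k g * parRep k h * parRep k h⁻¹ = parRep k (g * h) * parRep k h⁻¹ := by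
  refine eq_of_mul_idArr fun X => ?_
  simp only [mul_assoc, parRep_mul_idArr]
  by_cases hX : (h⁻¹)⁻¹ ∈ X.set
  · have h1 : (1 : G)⁻¹ ∈ X.set := by simpa using X.one_mem
    rw [parRep_mul_pairArr _ hX, parRep_mul_pairArr _ hX, mul_inv_cancel, mul_inv_cancel_right,
      parRep_mul_pairArr _ h1, mul_one]
  · simp [pairArr_of_notMem hX]

theorem parRep_left (g h : G) :
    parRep k g⁻¹ * parRep k g * parRep k h = parRep k g⁻¹ * parRep k (g * h) := by
  refine eq_of_mul_idArr fun X => ?_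
  simp only [mul_assoc, parRep_mul_idArr]
  by_cases hX : h⁻¹ ∈ X.set
  · rw [parRep_mul_pairArr _ hX]
  -- The left side is now `0`, but `(gh, X)` may be an arrow. Multiplying it by the element of `g⁻¹`
  -- gives `pairArr k h X`, which vanishes too.
  · by_cases hg : (g * h)⁻¹ ∈ X.set
    · rw [parRep_mul_pairArr _ hg, inv_mul_cancel_left, pairArr_of_notMem hX]
      simp
    · rw [pairArr_of_notMem hX, pairArr_of_notMem hg]
      simp

open PartialGroupAlgebra

variable (k G) in
/-- The algebra morphism `k_par G → k Γ(G)`. -/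
def toGroupoidAlgebra : PartialGroupAlgebra k G →ₐ[k] GroupoidAlgebra k (PE G) :=
  lift (parRep k) parRep_one parRep_right parRep_left

theorem toGroupoidAlgebra_of (g : G) : toGroupoidAlgebra k G (of k g) = parRep k g :=
  lift_of _ _ _ _ _

theorem toGroupoidAlgebra_eps_mul_idArr (g : G) (X : PE G) :
    toGroupoidAlgebra k G (eps k g) * GroupoidAlgebra.idArr k X =
      if g ∈ X.set then GroupoidAlgebra.idArr k X else 0 := by
  rw [eps, map_mul, toGroupoidAlgebra_of, toGroupoidAlgebra_of, mul_assoc, parRep_mul_idArr]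
  split_ifs with h
  · rw [parRep_mul_pairArr _ (by simpa using h), mul_inv_cancel, pairArr_one]
  · rw [pairArr_of_notMem (by simpa using h), mul_zero]

theorem toGroupoidAlgebra_aparAtom_mul_idArr {X : Finset G} {Y : PE G} (h : X ≠ Y.set) :
    toGroupoidAlgebra k G (aparAtom k X) * GroupoidAlgebra.idArr k Y = 0 := by
  -- A group element separating `X` from `Y` gives an idempotent `ε_g` that fixes one of the atom
  -- and the identity arrow and kills the other.
  obtain ⟨g, hg⟩ : ∃ g, ¬(g ∈ X ↔ g ∈ Y.set) := by
    by_contra! h'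
    exact h (Finset.ext h')
  have hcomm := Apar_comm_eps (aparAtom k X).2 g
  rw [eps_mul_aparAtom] at hcomm
  have h2 := toGroupoidAlgebra_eps_mul_idArr (k := k) g Y
  by_cases hX : g ∈ X
  · have hY : g ∉ Y.set := fun hY => hg (iff_of_true hX hY)
    rw [if_pos hX] at hcomm
    rw [if_neg hY] at h2
    rw [hcomm, map_mul, mul_assoc, h2, mul_zero]
  · have hY : g ∈ Y.set := by
      by_contra hY
      exact hg (iff_of_false hX hY)
    rw [if_neg hX] at hcomm
    rw [if_pos hY] at h2
    rw [← h2, ← mul_assoc, ← map_mul, ← hcomm, map_zero, zero_mul]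

/-- Applied to `∑ P_Y = 1` and multiplied by the identity arrow at `X`, the map leaves only the term
of `P_X`. -/
theorem toGroupoidAlgebra_aparAtom (X : PE G) :
    toGroupoidAlgebra k G (aparAtom k X.set) = GroupoidAlgebra.idArr k X := by
  refine eq_of_mul_idArr fun Y => ?_
  by_cases h : X = Y
  · subst h
    have h1 := congrArg (fun a => toGroupoidAlgebra k G a * GroupoidAlgebra.idArr k X)
      (sum_aparAtom (k := k) (G := G))
    simp only [map_sum, map_one, one_mul, Finset.sum_mul] at h1
    rw [Finset.sum_eq_single X (fun Y _ hY => toGroupoidAlgebra_aparAtom_mul_idArr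
      fun e => hY (PE.ext e)) (by simp)] at h1
    rw [h1, GroupoidAlgebra.idArr_mul_idArr]
  · rw [toGroupoidAlgebra_aparAtom_mul_idArr fun e => h (PE.ext e),
      GroupoidAlgebra.idArr_mul_idArr_of_ne h]

variable (k G) in
/-- The inverse `(g, X) ↦ [g] P_X`, where `P_X` is the atom of `A_par` belonging to `X`. -/
def ofGroupoidAlgebra : GroupoidAlgebra k (PE G) →ₗ[k] PartialGroupAlgebra k G :=
  GroupoidAlgebra.extend fun γ => of k (PE.Hom.val γ.hom) * aparAtom k γ.src.set

theorem toGroupoidAlgebra_ofGroupoidAlgebra (a : GroupoidAlgebra k (PE G)) :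
    toGroupoidAlgebra k G (ofGroupoidAlgebra k G a) = a := by
  refine LinearMap.congr_fun (f := (toGroupoidAlgebra k G).toLinearMap ∘ₗ ofGroupoidAlgebra k G)
    (g := LinearMap.id) (GroupoidAlgebra.hom_ext fun γ => ?_) a
  change toGroupoidAlgebra k G (ofGroupoidAlgebra k G (GroupoidAlgebra.arr k γ)) = _
  rw [ofGroupoidAlgebra, GroupoidAlgebra.extend_arr, map_mul, toGroupoidAlgebra_of,
    toGroupoidAlgebra_aparAtom, parRep_mul_idArr, pairArr_arr]
  rfl

theorem ofGroupoidAlgebra_pairArr (g : G) (X : PE G) :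
    ofGroupoidAlgebra k G (pairArr k g X) = of k g * aparAtom k X.set := by
  by_cases h : g⁻¹ ∈ X.set
  · rw [pairArr_of_mem h, ofGroupoidAlgebra, GroupoidAlgebra.extend_arr]
    rfl
  · rw [pairArr_of_notMem h, map_zero, of_mul_aparAtom h]

theorem of_mul_ofGroupoidAlgebra (g : G) (a : GroupoidAlgebra k (PE G)) :
    of k g * ofGroupoidAlgebra k G a = ofGroupoidAlgebra k G (parRep k g * a) := by
  refine LinearMap.congr_fun (f := LinearMap.mulLeft k (of k g) ∘ₗ ofGroupoidAlgebra k G)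
    (g := ofGroupoidAlgebra k G ∘ₗ LinearMap.mulLeft k (parRep k g))
    (GroupoidAlgebra.hom_ext fun γ => ?_) a
  change of k g * ofGroupoidAlgebra k G (GroupoidAlgebra.arr k γ) =
    ofGroupoidAlgebra k G (parRep k g * GroupoidAlgebra.arr k γ)
  have h := PE.Hom.inv_mem γ.hom
  rw [← pairArr_arr, ofGroupoidAlgebra_pairArr, parRep_mul_pairArr _ h, ofGroupoidAlgebra_pairArr,
    of_mul_of_mul_aparAtom _ h]

theorem ofGroupoidAlgebra_one : ofGroupoidAlgebra k G 1 = 1 := by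
  rw [← sum_idArr, map_sum, ← sum_aparAtom]
  refine Finset.sum_congr rfl fun X _ => ?_
  rw [← pairArr_one, ofGroupoidAlgebra_pairArr, of_one, one_mul]

/-- The image is stable under left multiplication by the generators `[g]`, hence is a left ideal,
and it contains `1`. -/
theorem ofGroupoidAlgebra_surjective : Function.Surjective (ofGroupoidAlgebra k G) := by
  have key : ∀ x ∈ Algebra.adjoin k (Set.range (of k (G := G))),
      ∀ a, ∃ b, ofGroupoidAlgebra k G b = x * ofGroupoidAlgebra k G a := by
    intro x hx
    induction hx using Algebra.adjoin_induction with
    | mem x hx =>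
      obtain ⟨g, rfl⟩ := hx
      exact fun a => ⟨_, (of_mul_ofGroupoidAlgebra g a).symm⟩
    | algebraMap r =>
      intro a
      exact ⟨r • a, by rw [map_smul, Algebra.smul_def]⟩
    | add x y _ _ hx hy =>
      intro a
      obtain ⟨b, hb⟩ := hx a
      obtain ⟨c, hc⟩ := hy a
      exact ⟨b + c, by rw [map_add, hb, hc, add_mul]⟩
    | mul x y _ _ hx hy =>
      intro a
      obtain ⟨b, hb⟩ := hy a
      obtain ⟨c, hc⟩ := hx b
      exact ⟨c, by rw [hc, hb, mul_assoc]⟩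
  intro x
  obtain ⟨b, hb⟩ := key x (by rw [adjoin_range_of]; trivial) 1
  exact ⟨b, by rw [hb, ofGroupoidAlgebra_one, mul_one]⟩

/-- A surjective right inverse is a two-sided inverse. -/
theorem toGroupoidAlgebra_bijective : Function.Bijective (toGroupoidAlgebra k G) := by
  refine ⟨fun x y h => ?_, fun a => ⟨_, toGroupoidAlgebra_ofGroupoidAlgebra a⟩⟩
  obtain ⟨a, rfl⟩ := ofGroupoidAlgebra_surjective x
  obtain ⟨b, rfl⟩ := ofGroupoidAlgebra_surjective y
  rw [toGroupoidAlgebra_ofGroupoidAlgebra, toGroupoidAlgebra_ofGroupoidAlgebra] at h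
  rw [h]

variable (k G) in
/-- The algebra isomorphism `k_par G ≃ k Γ(G)`. -/
def equivGroupoidAlgebra : PartialGroupAlgebra k G ≃ₐ[k] GroupoidAlgebra k (PE G) :=
  AlgEquiv.ofBijective (toGroupoidAlgebra k G) toGroupoidAlgebra_bijective

end Isomorphism

/-! ### The coproducts of the groupoid Hopf algebroid in terms of plain balancing over the base. -/

namespace GroupoidAlgebra

variable {k : Type w} [CommRing k] {C : Type u} [Groupoid.{v} C] [Fintype C]

variable (k C) in
theorem epsS'_comp_val : epsS' k (GroupoidAlgebra k C) ∘ₗ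
    (isWeakHopfAlgebra (k := k) (C := C)).targetAlg.val.toLinearMap =
      (isWeakHopfAlgebra (k := k) (C := C)).targetAlg.val.toLinearMap :=
  LinearMap.ext fun a => base_ext (g := LinearMap.id) epsS'_idArr a.2

variable (k C) in
theorem epsT'_comp_val : epsT' k (GroupoidAlgebra k C) ∘ₗ
    (isWeakHopfAlgebra (k := k) (C := C)).sourceAlg.val.toLinearMap =
      (isWeakHopfAlgebra (k := k) (C := C)).sourceAlg.val.toLinearMap :=
  LinearMap.ext fun a => base_ext (g := LinearMap.id) epsT'_idArr
    (targetAlg_eq_sourceAlg.symm.le a.2)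

/-- The two relation modules are equal, but the quotients are different types; the comparison
therefore goes through membership of the difference. -/
theorem left_rep_iff {x : GroupoidAlgebra k C ⊗[k] GroupoidAlgebra k C}
    {h : GroupoidAlgebra k C} :
    (isWeakHopfAlgebra (k := k) (C := C)).hopfAlgebroidData.left.Rep x h ↔
      (leftBal (isWeakHopfAlgebra (k := k) (C := C)).targetAlg).mkQ x =
        (leftBal (isWeakHopfAlgebra (k := k) (C := C)).targetAlg).mkQ (Coalgebra.comul h) := by
  have e := congrArg (leftRel (isWeakHopfAlgebra (k := k) (C := C)).targetAlg.val.toLinearMap)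
    (epsS'_comp_val k C)
  refine (Submodule.Quotient.eq _).trans (Iff.trans ?_ (Submodule.Quotient.eq _).symm)
  exact (SetLike.ext_iff.1 e _)

theorem right_rep_iff {x : GroupoidAlgebra k C ⊗[k] GroupoidAlgebra k C}
    {h : GroupoidAlgebra k C} :
    (isWeakHopfAlgebra (k := k) (C := C)).hopfAlgebroidData.right.Rep x h ↔
      (rightBal (isWeakHopfAlgebra (k := k) (C := C)).sourceAlg).mkQ x =
        (rightBal (isWeakHopfAlgebra (k := k) (C := C)).sourceAlg).mkQ (Coalgebra.comul h) := by
  have e := congrArg (rightRel (isWeakHopfAlgebra (k := k) (C := C)).sourceAlg.val.toLinearMap)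
    (epsT'_comp_val k C)
  refine (Submodule.Quotient.eq _).trans (Iff.trans ?_ (Submodule.Quotient.eq _).symm)
  exact (SetLike.ext_iff.1 e _)

theorem idArr_mem_sourceAlg (x : C) :
    idArr k x ∈ (isWeakHopfAlgebra (k := k) (C := C)).sourceAlg :=
  targetAlg_eq_sourceAlg.le (idArr_mem_targetAlg x)

end GroupoidAlgebra

/-! ### Compatibility of the isomorphism with bases, antipodes and coproducts. -/

section Isomorphism

variable {k : Type w} [CommRing k] {G : Type u} [Group G] [DecidableEq G] [Fintype G]

open PartialGroupAlgebra GroupoidAlgebra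

theorem equivGroupoidAlgebra_of (g : G) : equivGroupoidAlgebra k G (of k g) = parRep k g :=
  toGroupoidAlgebra_of g

/-- Each `ε_g` becomes a sum of identity arrows, and conversely the identity arrow at `X` is the
image of the atom of `X`. -/
theorem map_Apar : (Apar k G).map
    (equivGroupoidAlgebra k G : PartialGroupAlgebra k G →ₐ[k] GroupoidAlgebra k (PE G)) =
    (isWeakHopfAlgebra (k := k) (C := PE G)).targetAlg := by
  apply le_antisymm
  · rw [Apar, AlgHom.map_adjoin, Algebra.adjoin_le_iff]
    rintro _ ⟨_, ⟨g, rfl⟩, rfl⟩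
    change toGroupoidAlgebra k G (eps k g) ∈ (isWeakHopfAlgebra (k := k) (C := PE G)).targetAlg
    rw [← mul_one (toGroupoidAlgebra k G (eps k g)), ← sum_idArr, Finset.mul_sum]
    refine sum_mem fun X _ => ?_
    rw [toGroupoidAlgebra_eps_mul_idArr]
    split_ifs
    · exact idArr_mem_targetAlg X
    · exact zero_mem _
  · intro a ha
    have h : Submodule.span k (Set.range (idArr k)) ≤ Subalgebra.toSubmodule
        ((Apar k G).map
          (equivGroupoidAlgebra k G : PartialGroupAlgebra k G →ₐ[k] GroupoidAlgebra k (PE G))) := by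
      refine Submodule.span_le.2 ?_
      rintro _ ⟨X, rfl⟩
      exact ⟨aparAtom k X.set, (aparAtom k X.set).2, toGroupoidAlgebra_aparAtom X⟩
    exact h (mem_targetAlg.1 ha)

variable (k G) in
/-- The restriction `A_par ≃ H_t` of the isomorphism `k_par G ≃ k Γ(G)`. -/
def aparEquivTarget :
    Apar k G ≃ₐ[k] (isWeakHopfAlgebra (k := k) (C := PE G)).targetAlg :=
  ((equivGroupoidAlgebra k G).subalgebraMap (Apar k G)).trans (Subalgebra.equivOfEq _ _ map_Apar)

variable (k G) in
/-- The restriction `A_par ≃ H_s` of the isomorphism `k_par G ≃ k Γ(G)`. -/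
def aparEquivSource :
    Apar k G ≃ₐ[k] (isWeakHopfAlgebra (k := k) (C := PE G)).sourceAlg :=
  (aparEquivTarget k G).trans (Subalgebra.equivOfEq _ _ targetAlg_eq_sourceAlg)

theorem left_rep_parRep (g : G) :
    (isWeakHopfAlgebra (k := k) (C := PE G)).hopfAlgebroidData.left.Rep
      (parRep k g ⊗ₜ parRep k g) (parRep k g) := by
  rw [left_rep_iff, parRep, map_sum, TensorProduct.sum_tmul, map_sum, map_sum]
  refine Finset.sum_congr rfl fun X _ => ?_
  rw [TensorProduct.tmul_sum, map_sum, Finset.sum_eq_single X, comul_pairArr]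
  · intro Y _ hY
    by_cases h : g⁻¹ ∈ X.set
    -- In a mixed term the identity arrow at `gX` is split off from `(g, X)` and moved across the
    -- tensor sign. It annihilates `(g, Y)`, since `gY ≠ gX`.
    · rw [← idArr_mul_pairArr h, leftBal_bal (idArr_mem_targetAlg _), idArr_mul_pairArr_of_ne,
        TensorProduct.tmul_zero, map_zero]
      exact fun e => hY (PE.ext (smul_left_cancel g e).symm)
    · rw [pairArr_of_notMem h, TensorProduct.zero_tmul, map_zero]
  · simp

theorem right_rep_parRep (g : G) :
    (isWeakHopfAlgebra (k := k) (C := PE G)).hopfAlgebroidData.right.Rep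
      (parRep k g ⊗ₜ parRep k g) (parRep k g) := by
  rw [right_rep_iff, parRep, map_sum, TensorProduct.sum_tmul, map_sum, map_sum]
  refine Finset.sum_congr rfl fun X _ => ?_
  rw [TensorProduct.tmul_sum, map_sum, Finset.sum_eq_single X, comul_pairArr]
  · intro Y _ hY
    -- The same with sources: the identity arrow at `X` moves across and annihilates `(g, Y)` from
    -- the right.
    rw [← pairArr_mul_idArr g X, rightBal_bal (idArr_mem_sourceAlg _),
      pairArr_mul_idArr_of_ne g (Ne.symm hY), TensorProduct.tmul_zero, map_zero]
  · simp

/-- The inversion of the arrows belonging to `g`, on the level of their sources. -/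
def translateEquiv (g : G) : {X : PE G // g⁻¹ ∈ X.set} ≃ {X : PE G // g⁻¹⁻¹ ∈ X.set} where
  toFun X := ⟨X.1.translate g X.2, by
    rw [inv_inv]
    exact Finset.mem_smul_finset.2 ⟨1, X.1.one_mem, by simp⟩⟩
  invFun X := ⟨X.1.translate g⁻¹ X.2, Finset.mem_smul_finset.2 ⟨1, X.1.one_mem, by simp⟩⟩
  left_inv X := Subtype.ext (PE.ext (inv_smul_smul g X.1.set))
  right_inv X := Subtype.ext (PE.ext (smul_inv_smul g X.1.set))

theorem antipode_parRep (g : G) : GroupoidAlgebra.antipode (parRep k g) = parRep k g⁻¹ := by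
  rw [parRep_eq_sum, parRep_eq_sum, map_sum]
  refine Fintype.sum_equiv (translateEquiv g) _ _ fun X => ?_
  rw [GroupoidAlgebra.antipode_arr]
  exact congrArg _ (Arr.ext_of_val rfl rfl)

theorem equivGroupoidAlgebra_antipode (h : PartialGroupAlgebra k G) :
    equivGroupoidAlgebra k G (PartialGroupAlgebra.antipode h) =
      GroupoidAlgebra.antipode (equivGroupoidAlgebra k G h) := by
  refine (PartialGroupAlgebra.isDiagonal k G).linearMap_ext
    (f := (equivGroupoidAlgebra k G).toLinearMap ∘ₗ PartialGroupAlgebra.antipode)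
    (g := GroupoidAlgebra.antipode ∘ₗ (equivGroupoidAlgebra k G).toLinearMap)
    (fun m hm => ?_) h
  simp only [LinearMap.comp_apply, AlgEquiv.toLinearMap_apply]
  induction hm using Submonoid.closure_induction with
  | mem x hx =>
    obtain ⟨g, rfl⟩ := hx
    rw [antipode_of, equivGroupoidAlgebra_of, equivGroupoidAlgebra_of, antipode_parRep]
  | one => rw [antipode_one, map_one, (GroupoidAlgebra.isDiagonal k (PE G)).S_one]
  | mul x y _ _ hx hy =>
    rw [PartialGroupAlgebra.antipode_mul, map_mul, map_mul, GroupoidAlgebra.antipode_mul, hx, hy]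

/-- Group-likeness modulo balancing passes from the generators to all monomials, because the
coproduct of the groupoid Hopf algebroid is already known to be multiplicative. -/
theorem left_rep_monomial {m : PartialGroupAlgebra k G} (hm : m ∈ monomials k G) :
    (isWeakHopfAlgebra (k := k) (C := PE G)).hopfAlgebroidData.left.Rep
      (equivGroupoidAlgebra k G m ⊗ₜ equivGroupoidAlgebra k G m)
      (equivGroupoidAlgebra k G m) := by
  have hH := GroupoidAlgebra.isHopfAlgebroid k (PE G)
  induction hm using Submonoid.closure_induction with
  | mem x hx =>
    obtain ⟨g, rfl⟩ := hx
    rw [equivGroupoidAlgebra_of]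
    exact left_rep_parRep g
  | one =>
    rw [map_one]
    exact hH.isLeft.comul_one
  | mul x y _ _ hx hy =>
    rw [map_mul, ← Algebra.TensorProduct.tmul_mul_tmul]
    exact hH.isLeft.comul_mul _ _ _ _ hx hy

theorem left_rep_map {h : PartialGroupAlgebra k G}
    {x : PartialGroupAlgebra k G ⊗[k] PartialGroupAlgebra k G}
    (hx : (PartialGroupAlgebra.hopfAlgebroidData k G).left.Rep x h) :
    (isWeakHopfAlgebra (k := k) (C := PE G)).hopfAlgebroidData.left.Rep
      (TensorProduct.map (equivGroupoidAlgebra k G).toLinearMap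
        (equivGroupoidAlgebra k G).toLinearMap x) (equivGroupoidAlgebra k G h) := by
  rw [left_rep_iff]
  -- `λ ⊗ λ` descends to the balanced products because `λ` maps `A_par` into `H_t`. This reduces the
  -- claim to the representative `diag h`, and then by linearity to monomials.
  have h1 := leftBal_congr (A := Apar k G) (y := diag h)
    ((leftBal (isWeakHopfAlgebra (k := k) (C := PE G)).targetAlg).mkQ ∘ₗ TensorProduct.map
      (equivGroupoidAlgebra k G).toLinearMap (equivGroupoidAlgebra k G).toLinearMap)
    (fun a ha u v => by
      simp only [LinearMap.comp_apply, TensorProduct.map_tmul, AlgEquiv.toLinearMap_apply, map_mul]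
      exact leftBal_bal (aparEquivTarget k G ⟨a, ha⟩).2 _ _) hx
  refine h1.trans ?_
  refine (PartialGroupAlgebra.isDiagonal k G).linearMap_ext
    (f := ((leftBal (isWeakHopfAlgebra (k := k) (C := PE G)).targetAlg).mkQ ∘ₗ TensorProduct.map
      (equivGroupoidAlgebra k G).toLinearMap (equivGroupoidAlgebra k G).toLinearMap) ∘ₗ
        diag.toLinearMap)
    (g := (leftBal (isWeakHopfAlgebra (k := k) (C := PE G)).targetAlg).mkQ ∘ₗ Coalgebra.comul ∘ₗ
      (equivGroupoidAlgebra k G).toLinearMap) (fun m hm => ?_) h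
  simp only [LinearMap.comp_apply]
  rw [(PartialGroupAlgebra.isDiagonal k G).comul_mem m hm, TensorProduct.map_tmul]
  exact left_rep_iff.1 (left_rep_monomial hm)

theorem right_rep_monomial {m : PartialGroupAlgebra k G} (hm : m ∈ monomials k G) :
    (isWeakHopfAlgebra (k := k) (C := PE G)).hopfAlgebroidData.right.Rep
      (equivGroupoidAlgebra k G m ⊗ₜ equivGroupoidAlgebra k G m)
      (equivGroupoidAlgebra k G m) := by
  have hH := GroupoidAlgebra.isHopfAlgebroid k (PE G)
  induction hm using Submonoid.closure_induction with
  | mem x hx =>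
    obtain ⟨g, rfl⟩ := hx
    rw [equivGroupoidAlgebra_of]
    exact right_rep_parRep g
  | one =>
    rw [map_one]
    exact hH.isRight.comul_one
  | mul x y _ _ hx hy =>
    rw [map_mul, ← Algebra.TensorProduct.tmul_mul_tmul]
    exact hH.isRight.comul_mul _ _ _ _ hx hy

theorem right_rep_map {h : PartialGroupAlgebra k G}
    {x : PartialGroupAlgebra k G ⊗[k] PartialGroupAlgebra k G}
    (hx : (PartialGroupAlgebra.hopfAlgebroidData k G).right.Rep x h) :
    (isWeakHopfAlgebra (k := k) (C := PE G)).hopfAlgebroidData.right.Rep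
      (TensorProduct.map (equivGroupoidAlgebra k G).toLinearMap
        (equivGroupoidAlgebra k G).toLinearMap x) (equivGroupoidAlgebra k G h) := by
  rw [right_rep_iff]
  have h1 := rightBal_congr (A := Apar k G) (y := diag h)
    ((rightBal (isWeakHopfAlgebra (k := k) (C := PE G)).sourceAlg).mkQ ∘ₗ TensorProduct.map
      (equivGroupoidAlgebra k G).toLinearMap (equivGroupoidAlgebra k G).toLinearMap)
    (fun a ha u v => by
      simp only [LinearMap.comp_apply, TensorProduct.map_tmul, AlgEquiv.toLinearMap_apply, map_mul]
      exact rightBal_bal (aparEquivSource k G ⟨a, ha⟩).2 _ _) hx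
  refine h1.trans ?_
  refine (PartialGroupAlgebra.isDiagonal k G).linearMap_ext
    (f := ((rightBal (isWeakHopfAlgebra (k := k) (C := PE G)).sourceAlg).mkQ ∘ₗ TensorProduct.map
      (equivGroupoidAlgebra k G).toLinearMap (equivGroupoidAlgebra k G).toLinearMap) ∘ₗ
        diag.toLinearMap)
    (g := (rightBal (isWeakHopfAlgebra (k := k) (C := PE G)).sourceAlg).mkQ ∘ₗ Coalgebra.comul ∘ₗ
      (equivGroupoidAlgebra k G).toLinearMap) (fun m hm => ?_) h
  simp only [LinearMap.comp_apply]
  rw [(PartialGroupAlgebra.isDiagonal k G).comul_mem m hm, TensorProduct.map_tmul]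
  exact right_rep_iff.1 (right_rep_monomial hm)

theorem epsS_aparEquivTarget (a : Apar k G) :
    epsS k (GroupoidAlgebra k (PE G)) (aparEquivTarget k G a) = aparEquivTarget k G a :=
  base_ext (f := epsS k _) (g := LinearMap.id) (fun x => epsS_arr ⟨x, x, 𝟙 x⟩)
    (aparEquivTarget k G a).2

variable (k G) in
theorem isHopfAlgebroidIso_equivGroupoidAlgebra : IsHopfAlgebroidIso (hopfAlgebroidData k G)
    (isWeakHopfAlgebra (k := k) (C := PE G)).hopfAlgebroidData (equivGroupoidAlgebra k G)
    (aparEquivTarget k G) (aparEquivSource k G) :=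
  isHopfAlgebroidIso_of (PartialGroupAlgebra.isHopfAlgebroid k G)
    (GroupoidAlgebra.isHopfAlgebroid k (PE G)) Subtype.val_injective Subtype.val_injective
    (fun _ => rfl)
    (fun a => LinearMap.congr_fun (epsS'_comp_val k (PE G)) (aparEquivTarget k G a))
    (fun _ _ => left_rep_map) (fun _ => rfl)
    (fun a => LinearMap.congr_fun (epsT'_comp_val k (PE G)) (aparEquivSource k G a))
    (fun _ _ => right_rep_map) (fun a => Subtype.ext (epsS_aparEquivTarget a).symm)
    equivGroupoidAlgebra_antipode

end Isomorphism

end ParHopf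

end

theorem theorem3p5 (k : Type*) [Field k] [IsAlgClosed k] [CharZero k]
    (G : Type*) [Group G] [Fintype G] [DecidableEq G] :
    -- `k_par G` is a Hopf algebroid over `A_par`
    ParHopf.IsHopfAlgebroid (ParHopf.PartialGroupAlgebra.hopfAlgebroidData k G) ∧
    -- `k Γ(G)` is a Hopf algebroid, by means of its weak Hopf algebra structure
    ParHopf.IsHopfAlgebroid
      (ParHopf.GroupoidAlgebra.isWeakHopfAlgebra (k := k) (C := ParHopf.PE G)).hopfAlgebroidData ∧
    -- the algebra isomorphism `λ` is an isomorphism of Hopf algebroids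
    ∃ lam : ParHopf.PartialGroupAlgebra k G ≃ₐ[k] ParHopf.GroupoidAlgebra k (ParHopf.PE G),
      (∀ g : G, lam (ParHopf.PartialGroupAlgebra.of k g) =
        ∑ X : {X : ParHopf.PE G // g⁻¹ ∈ X.set},
          ParHopf.GroupoidAlgebra.arr k (ParHopf.pair g X.1 X.2)) ∧
      ∃ φ ψ, ParHopf.IsHopfAlgebroidIso (ParHopf.PartialGroupAlgebra.hopfAlgebroidData k G)
        (ParHopf.GroupoidAlgebra.isWeakHopfAlgebra (k := k) (C := ParHopf.PE G)).hopfAlgebroidData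
        lam φ ψ :=
  ⟨ParHopf.PartialGroupAlgebra.isHopfAlgebroid k G, ParHopf.GroupoidAlgebra.isHopfAlgebroid k _,
    ParHopf.equivGroupoidAlgebra k G,
    fun g => (ParHopf.equivGroupoidAlgebra_of g).trans (ParHopf.parRep_eq_sum g),
    _, _, ParHopf.isHopfAlgebroidIso_equivGroupoidAlgebra k G⟩
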